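/- Let $d \ge 1$. Let $\mathcal{F}_d$ be the class of upper semicontinuous log-concave probability densities $f:\mathbb{R}^d \to [0,\infty)$ with respect to Lebesgue measure (log-concave meaning that $\log f:\mathbb{R}^d\to[-\infty,\infty)$ is concave, with $\log 0 := -\infty$), and let $\mathcal{P}_d$ be the class of probability measures $P$ on $\mathbb{R}^d$ with $\int \|x\| \, dP(x) < \infty$ and $P(H) < 1$ for every hyperplane $H$. For $P \in \mathcal{P}_d$ let \[ \psi^*(P) := \operatorname*{argmax}_{f \in \mathcal{F}_d} \int_{\mathbb{R}^d} \log f \, dP , \] and say that $\psi^*(Q)$ is well-defined if $Q \in \mathcal{P}_d$ and the maximiser over $\mathcal{F}_d$ exists and is unique. Let $X_1, X_2, \ldots$ be independent random vectors with common distribution $P \in \mathcal{P}_d$, and let $\mathbb{P}_n := n^{-1}\sum_{i=1}^n \delta_{X_i}$ be the empirical distribution. Then $f^* := \psi^*(P)$ is well-defined, there exist $\alpha_0 > 0$ and $\beta_0 \in \mathbb{R}$ with \[ f^*(x) \le e^{-\alpha_0\|x\|+\beta_0} \quad \text{for all } x \in \mathbb{R}^d, \qquad (*) \] and, with probability one,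 both of the following hold: $\hat f_n := \psi^*(\mathbb{P}_n)$ is well-defined for all sufficiently large $n$; and for all $\alpha_0 > 0$ and $\beta_0 \in \mathbb{R}$ satisfying $(*)$ and every real $\alpha < \alpha_0$, \[ \int_{\mathbb{R}^d} e^{\alpha\|x\|} \, |\hat f_n(x) - f^*(x)| \, dx \to 0 \quad \text{as } n \to \infty . \] -/

import Mathlib

open MeasureTheory ProbabilityTheory Filter Topology

namespace LogConcaveMLE

noncomputable section

/-- The logarithm of `f : ℝᵈ → [0,∞)`, as a function into `[-∞,∞)`, with `log 0 = -∞`. -/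
def logFun {d : ℕ} (f : EuclideanSpace ℝ (Fin d) → ℝ) (x : EuclideanSpace ℝ (Fin d)) : EReal :=
  ENNReal.log (ENNReal.ofReal (f x))

/-- Concavity of a function on `ℝᵈ` with values in `[-∞,∞)`. A positive multiple of `⊥ : EReal`
is `⊥`, and `⊥` plus anything is `⊥`. -/
def IsConcave {d : ℕ} (φ : EuclideanSpace ℝ (Fin d) → EReal) : Prop :=
  ∀ x y : EuclideanSpace ℝ (Fin d), ∀ a b : ℝ, 0 < a → 0 < b → a + b = 1 →
    (a : EReal) * φ x + (b : EReal) * φ y ≤ φ (a • x + b • y)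

/-- The class `𝓕_d` of upper semicontinuous log-concave densities on `ℝᵈ`. -/
structure IsLogConcaveDensity {d : ℕ} (f : EuclideanSpace ℝ (Fin d) → ℝ) : Prop where
  nonneg : ∀ x, 0 ≤ f x
  usc : UpperSemicontinuous f
  concave_log : IsConcave (logFun f)
  lintegral_eq_one : ∫⁻ x, ENNReal.ofReal (f x) = 1

/-- The integral `∫ φ dP ∈ [-∞,∞]` of an extended-real function, as the integral of the positive
part minus the integral of the negative part. A density in `𝓕_d` is bounded, so for its logarithm
and a finite measure the first term is finite. -/
def extIntegral {d : ℕ} (φ : EuclideanSpace ℝ (Fin d) → EReal)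
    (P : Measure (EuclideanSpace ℝ (Fin d))) : EReal :=
  ((∫⁻ x, (φ x).toENNReal ∂P : ENNReal) : EReal) - ((∫⁻ x, (-φ x).toENNReal ∂P : ENNReal) : EReal)

/-- The class `𝓟_d` of probability measures on `ℝᵈ` with finite first moment that give mass
less than one to every hyperplane. -/
structure InClassP {d : ℕ} (P : Measure (EuclideanSpace ℝ (Fin d))) : Prop where
  isProbabilityMeasure : IsProbabilityMeasure P
  finite_mean : ∫⁻ x, ENNReal.ofReal ‖x‖ ∂P < ⊤
  hyperplane_lt_one : ∀ v : EuclideanSpace ℝ (Fin d), v ≠ 0 → ∀ c : ℝ,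
    P {x | inner ℝ v x = c} < 1

/-- `f` is a maximiser of `g ↦ ∫ log g dP` over `g ∈ 𝓕_d`. -/
def IsMaximiser {d : ℕ} (P : Measure (EuclideanSpace ℝ (Fin d)))
    (f : EuclideanSpace ℝ (Fin d) → ℝ) : Prop :=
  IsLogConcaveDensity f ∧
    ∀ g : EuclideanSpace ℝ (Fin d) → ℝ, IsLogConcaveDensity g →
      extIntegral (logFun g) P ≤ extIntegral (logFun f) P

/-- `ψ*(P)` is well-defined: `P` lies in `𝓟_d`, and the maximiser exists and is unique. -/
def ProjWellDefined {d : ℕ} (P : Measure (EuclideanSpace ℝ (Fin d))) : Prop :=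
  InClassP P ∧ ∃! f : EuclideanSpace ℝ (Fin d) → ℝ, IsMaximiser P f

open Classical in
/-- The log-concave projection `ψ*(P) = argmax_{f ∈ 𝓕_d} ∫ log f dP`
(with the value `0` if there is no maximiser). -/
def logConcaveProj {d : ℕ} (P : Measure (EuclideanSpace ℝ (Fin d))) :
    EuclideanSpace ℝ (Fin d) → ℝ :=
  if h : ∃ f : EuclideanSpace ℝ (Fin d) → ℝ, IsMaximiser P f then h.choose else 0

/-- The empirical distribution `n⁻¹ ∑_{i < n} δ_{x i}` of the first `n` points of a sequence. -/
def empirical {d : ℕ} (x : ℕ → EuclideanSpace ℝ (Fin d)) (n : ℕ) :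
    Measure (EuclideanSpace ℝ (Fin d)) :=
  (n : ENNReal)⁻¹ • ∑ i ∈ Finset.range n, Measure.dirac (x i)

end

end LogConcaveMLE

/-!
A law `P` in `𝓟_d` charges finitely many open sets such that every convex set meeting all of them
contains a fixed ball. A measure `Q` weakly close to `P` charges the same sets. If moreover the
log-likelihood of a density `f` under `Q` is bounded below, then `f` is bounded above: were its peak
very high, the level set of a moderate height would have small volume, so that it would miss one of
the sets, which would cost too much likelihood. The likelihood bound also makes `f` bounded below on
the ball, and total mass one then forces an exponential envelope with constants depending on `P` and
the likelihood bound only.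

Densities with common such bounds are compact for the convergence of hypographs, in which the
log-likelihood is upper semicontinuous jointly with weak convergence of `Q` (apply Fatou's lemma to
its layer cake representation), while for log-concave functions the convergence holds almost
everywhere. Hence a maximiser exists, and maximisers for `Q` have all their limit points among the
maximisers for `P` as soon as the likelihood of the latter under `Q` converges; under empirical
measures this is the strong law of large numbers. Uniqueness is the equality case of the inequality
of arithmetic and geometric means: the geometric mean of two maximisers has maximal likelihood, and
it would become larger still after normalisation if its mass were below one.

The exponential rate of the convergence is inherited from the limit: for `α' < α₀` the maximiser for
`P` lies strictly below the envelope of rate `α'` on a large sphere, hence so do the approximating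
maximisers eventually, and log-concavity propagates this bound beyond the sphere.
-/

namespace LogConcaveMLE

open Metric

/-- A nonnegative function whose logarithm is concave. The inequality is kept in multiplicative
form, so that zeros of `f` need no convention about `log 0`. -/
structure LogConcave {E : Type*} [AddCommGroup E] [Module ℝ E] (f : E → ℝ) : Prop where
  nonneg : ∀ x, 0 ≤ f x
  rpow_mul_rpow_le : ∀ x y, ∀ a b : ℝ, 0 < a → 0 < b → a + b = 1 →
    f x ^ a * f y ^ b ≤ f (a • x + b • y)

namespace LogConcave

section Module

variable {E : Type*} [AddCommGroup E] [Module ℝ E] {f : E → ℝ} {x y : E} {a b p q : ℝ}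

theorem le_of_le (hf : LogConcave f) (ha : 0 < a) (hb : 0 < b) (hab : a + b = 1) (hp : 0 ≤ p)
    (hq : 0 ≤ q) (hx : p ≤ f x) (hy : q ≤ f y) : p ^ a * q ^ b ≤ f (a • x + b • y) :=
  (mul_le_mul (Real.rpow_le_rpow hp hx ha.le) (Real.rpow_le_rpow hq hy hb.le)
    (Real.rpow_nonneg hq b) (Real.rpow_nonneg (hp.trans hx) a)).trans
    (hf.rpow_mul_rpow_le x y a b ha hb hab)

theorem exp_le (hf : LogConcave f) (ha : 0 < a) (hb : 0 < b) (hab : a + b = 1)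
    (hx : Real.exp p ≤ f x) (hy : Real.exp q ≤ f y) :
    Real.exp (a * p + b * q) ≤ f (a • x + b • y) := by
  have := hf.le_of_le ha hb hab (Real.exp_pos p).le (Real.exp_pos q).le hx hy
  rwa [← Real.exp_mul, ← Real.exp_mul, ← Real.exp_add, mul_comm p, mul_comm q] at this

theorem convex_superlevel (hf : LogConcave f) {c : ℝ} (hc : 0 < c) : Convex ℝ {x | c ≤ f x} := by
  rw [convex_iff_forall_pos]
  intro x hx y hy a b ha hb hab
  have := hf.le_of_le ha hb hab hc.le hc.le hx hy
  rwa [← Real.rpow_add hc, hab, Real.rpow_one] at this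

theorem convex_support (hf : LogConcave f) : Convex ℝ {x | 0 < f x} := by
  rw [convex_iff_forall_pos]
  intro x hx y hy a b ha hb hab
  exact (mul_pos (Real.rpow_pos_of_pos hx a) (Real.rpow_pos_of_pos hy b)).trans_le
    (hf.rpow_mul_rpow_le x y a b ha hb hab)

theorem concaveOn_log (hf : LogConcave f) {s : Set E} (hs : Convex ℝ s)
    (hpos : ∀ x ∈ s, 0 < f x) : ConcaveOn ℝ s fun x => Real.log (f x) := by
  rw [concaveOn_iff_forall_pos]
  refine ⟨hs, fun x hx y hy a b ha hb hab => ?_⟩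
  have hxa := Real.rpow_pos_of_pos (hpos x hx) a
  have hyb := Real.rpow_pos_of_pos (hpos y hy) b
  have h := Real.log_le_log (mul_pos hxa hyb) (hf.rpow_mul_rpow_le x y a b ha hb hab)
  rwa [Real.log_mul hxa.ne' hyb.ne', Real.log_rpow (hpos x hx), Real.log_rpow (hpos y hy)] at h

theorem div_const (hf : LogConcave f) {c : ℝ} (hc : 0 < c) : LogConcave fun x => f x / c where
  nonneg x := div_nonneg (hf.nonneg x) hc.le
  rpow_mul_rpow_le x y a b ha hb hab := by
    have hca : c ^ a * c ^ b = c := by rw [← Real.rpow_add hc, hab, Real.rpow_one]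
    rw [Real.div_rpow (hf.nonneg x) hc.le, Real.div_rpow (hf.nonneg y) hc.le, div_mul_div_comm,
      hca]
    gcongr
    exact hf.rpow_mul_rpow_le x y a b ha hb hab

theorem sqrt_mul {g : E → ℝ} (hf : LogConcave f) (hg : LogConcave g) :
    LogConcave fun x => √(f x * g x) where
  nonneg x := Real.sqrt_nonneg _
  rpow_mul_rpow_le x y a b ha hb hab := by
    have hpow (z : E) (c : ℝ) : √(f z * g z) ^ c = √(f z ^ c * g z ^ c) := by
      rw [← Real.mul_rpow (hf.nonneg z) (hg.nonneg z), Real.sqrt_eq_rpow, Real.sqrt_eq_rpow,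
        ← Real.rpow_mul (mul_nonneg (hf.nonneg z) (hg.nonneg z)), mul_comm (1 / 2) c,
        Real.rpow_mul (mul_nonneg (hf.nonneg z) (hg.nonneg z))]
    have hx (c : ℝ) : 0 ≤ f x ^ c := Real.rpow_nonneg (hf.nonneg x) c
    have hy (c : ℝ) : 0 ≤ g x ^ c := Real.rpow_nonneg (hg.nonneg x) c
    rw [hpow, hpow, ← Real.sqrt_mul (mul_nonneg (hx a) (hy a)), mul_mul_mul_comm]
    refine Real.sqrt_le_sqrt (mul_le_mul (hf.rpow_mul_rpow_le x y a b ha hb hab)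
      (hg.rpow_mul_rpow_le x y a b ha hb hab) ?_ (hf.nonneg _))
    exact mul_nonneg (hy a) (Real.rpow_nonneg (hg.nonneg y) b)

end Module

end LogConcave

section Ball

variable {E : Type*} [SeminormedAddCommGroup E] [NormedSpace ℝ E] {x₀ z : E} {l ρ : ℝ}

theorem image_ball_convexCombo (hl : 0 < l) :
    (fun y => (1 - l) • z + l • y) '' ball x₀ ρ = ball ((1 - l) • z + l • x₀) (l * ρ) := by
  have h := smul_ball hl.ne' x₀ ρ
  rw [Real.norm_of_nonneg hl.le] at h
  rw [← vadd_eq_add, ← vadd_ball, ← h, ← Set.image_vadd, ← Set.image_smul, Set.image_image]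
  rfl

theorem ball_convexCombo_subset {C : Set E} (hC : Convex ℝ C) (hball : ball x₀ ρ ⊆ C)
    (hz : z ∈ C) (hl0 : 0 < l) (hl1 : l ≤ 1) :
    ball ((1 - l) • z + l • x₀) (l * ρ) ⊆ C := by
  rw [← image_ball_convexCombo hl0, Set.image_subset_iff]
  exact fun y hy => hC hz (hball hy) (sub_nonneg.2 hl1) hl0.le (by ring)

theorem LogConcave.exp_le_on_ball {f : E → ℝ} {m t : ℝ} (hf : LogConcave f)
    (hball : ∀ y ∈ ball x₀ ρ, Real.exp t ≤ f y) (hz : Real.exp m ≤ f z) (hl0 : 0 < l)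
    (hl1 : l < 1) :
    ∀ y ∈ ball ((1 - l) • z + l • x₀) (l * ρ), Real.exp ((1 - l) * m + l * t) ≤ f y := by
  rw [← image_ball_convexCombo hl0, Set.forall_mem_image]
  exact fun y hy => hf.exp_le (sub_pos.2 hl1) hl0 (by ring) hz (hball y hy)

end Ball

namespace LogConcave

section Normed

variable {E : Type*} [SeminormedAddCommGroup E] [NormedSpace ℝ E] {f : E → ℝ} {x₀ z : E}
  {t s R M : ℝ}

theorem le_exp_of_le_on_sphere (hf : LogConcave f) (hR : 0 < R) (h0 : Real.exp t ≤ f x₀)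
    (hs : ∀ w ∈ sphere x₀ R, f w ≤ Real.exp (t - s)) (hz : R ≤ ‖z - x₀‖) :
    f z ≤ Real.exp (t - s * ‖z - x₀‖ / R) := by
  rcases hz.eq_or_lt with hz | hz
  · rw [← hz, mul_div_assoc, div_self hR.ne', mul_one]
    exact hs z (mem_sphere_iff_norm.2 hz.symm)
  rcases (hf.nonneg z).eq_or_lt with hfz | hfz
  · rw [← hfz]; positivity
  have hr : 0 < ‖z - x₀‖ := hR.trans hz
  generalize hl : R / ‖z - x₀‖ = l
  have hl0 : 0 < l := hl ▸ div_pos hR hr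
  have hl1 : l < 1 := hl ▸ (div_lt_one hr).2 hz
  have hlR : l * ‖z - x₀‖ = R := by rw [← hl, div_mul_cancel₀ _ hr.ne']
  have hmem : (1 - l) • x₀ + l • z ∈ sphere x₀ R := by
    have : (1 - l) • x₀ + l • z - x₀ = l • (z - x₀) := by module
    rw [mem_sphere_iff_norm, this, norm_smul, Real.norm_of_nonneg hl0.le, hlR]
  have hcombo : (1 - l) * t + l * Real.log (f z) ≤ t - s :=
    Real.exp_le_exp.1 ((hf.exp_le (sub_pos.2 hl1) hl0 (by ring) h0
      (Real.exp_log hfz).le).trans (hs _ hmem))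
  rw [← Real.exp_log hfz, Real.exp_le_exp, ← hlR, mul_div_mul_right _ _ hr.ne', le_sub_iff_add_le,
    ← le_sub_iff_add_le', div_le_iff₀ hl0]
  linarith

theorem le_exp_sub_norm (hf : LogConcave f) (hR : 0 < R) (hs0 : 0 ≤ s) (h0 : Real.exp t ≤ f x₀)
    (hs : ∀ w ∈ sphere x₀ R, f w ≤ Real.exp (t - s)) (hM : ∀ x, f x ≤ Real.exp M) (x : E) :
    f x ≤ Real.exp (max t (M + s) + s / R * ‖x₀‖ - s / R * ‖x‖) := by
  have hsR : 0 ≤ s / R := div_nonneg hs0 hR.le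
  have htri : s / R * ‖x‖ - s / R * ‖x₀‖ ≤ s / R * ‖x - x₀‖ := by
    rw [← mul_sub]; gcongr; exact norm_sub_norm_le x x₀
  rcases le_total R ‖x - x₀‖ with hx | hx
  · refine (hf.le_exp_of_le_on_sphere hR h0 hs hx).trans (Real.exp_le_exp.2 ?_)
    rw [mul_div_right_comm]
    linarith [le_max_left t (M + s)]
  · refine (hM x).trans (Real.exp_le_exp.2 ?_)
    have : s / R * ‖x - x₀‖ ≤ s :=
      (mul_le_mul_of_nonneg_left hx hsR).trans_eq (div_mul_cancel₀ s hR.ne')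
    linarith [le_max_right t (M + s)]

end Normed

theorem continuousOn {E : Type*} [NormedAddCommGroup E] [NormedSpace ℝ E] [FiniteDimensional ℝ E]
    {f : E → ℝ} (hf : LogConcave f) {s : Set E} (hs : Convex ℝ s) (hso : IsOpen s)
    (hpos : ∀ x ∈ s, 0 < f x) : ContinuousOn f s :=
  ((hf.concaveOn_log hs hpos).continuousOn hso).rexp.congr fun x hx =>
    (Real.exp_log (hpos x hx)).symm

end LogConcave

section BallForcing

variable {E : Type*} [NormedAddCommGroup E] [InnerProductSpace ℝ E]

/-- Every convex set that meets all members of `s` contains the ball of radius `ρ` around `x`. A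
log-concave function that is large somewhere in each member of `s` is then large on the ball. -/
def IsBallForcing (s : Finset (Set E)) (x : E) (ρ : ℝ) : Prop :=
  ∀ C, Convex ℝ C → (∀ A ∈ s, (C ∩ A).Nonempty) → ball x ρ ⊆ C

theorem ball_subset_convexHull [CompleteSpace E] {Y : Set E} (hY : Y.Finite) (hne : Y.Nonempty)
    {x : E} {ρ : ℝ} (h : ∀ w : E, ‖w‖ = 1 → ∃ y ∈ Y, ρ ≤ inner ℝ w (y - x)) :
    ball x ρ ⊆ convexHull ℝ Y := by
  intro x' hx'
  by_contra hmem
  obtain ⟨g, r, hgx, hgY⟩ := geometric_hahn_banach_point_closed (convex_convexHull ℝ Y)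
    (hY.isClosed_convexHull ℝ) hmem
  obtain ⟨v, rfl⟩ := (InnerProductSpace.toDual ℝ E).surjective g
  simp only [InnerProductSpace.toDual_apply_apply] at hgx hgY
  have hlt (y : E) (hy : y ∈ Y) : inner ℝ v x' < inner ℝ v y :=
    hgx.trans (hgY y (subset_convexHull ℝ Y hy))
  have hv : 0 < ‖v‖ := by
    obtain ⟨y, hy⟩ := hne
    refine norm_pos_iff.2 fun h0 => ?_
    simpa [h0] using hlt y hy
  obtain ⟨y, hy, hρ⟩ := h (-(‖v‖⁻¹ • v)) (by
    rw [norm_neg, norm_smul, norm_inv, norm_norm, inv_mul_cancel₀ hv.ne'])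
  have hxx' : inner ℝ v (x - x') < ‖v‖ * ρ :=
    (real_inner_le_norm v (x - x')).trans_lt
      (mul_lt_mul_of_pos_left (mem_ball_iff_norm'.1 hx') hv)
  rw [inner_neg_left, real_inner_smul_left, le_neg, inv_mul_le_iff₀ hv, mul_neg] at hρ
  have hsum := inner_add_right (𝕜 := ℝ) v (y - x) (x - x')
  rw [sub_add_sub_cancel, inner_sub_right] at hsum
  linarith [hlt y hy]

theorem eventually_forall_le_inner_sub {A : Set E} (hA : Bornology.IsBounded A) {x u : E}
    {c c' : ℝ} (hc : c' < c) (h : ∀ y ∈ A, c ≤ inner ℝ u (y - x)) :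
    ∀ᶠ v in 𝓝 u, ∀ y ∈ A, c' ≤ inner ℝ v (y - x) := by
  obtain ⟨R, hR⟩ := hA.exists_norm_le
  have hsmall : ∀ᶠ v in 𝓝 u, ‖v - u‖ * (R + ‖x‖) < c - c' := by
    refine ContinuousAt.eventually_lt (by fun_prop) continuousAt_const ?_
    simpa using hc
  filter_upwards [hsmall] with v hv y hy
  have hyx : ‖y - x‖ ≤ R + ‖x‖ := (norm_sub_le y x).trans (by gcongr; exact hR y hy)
  have hdiff := (abs_le.1 ((abs_real_inner_le_norm (v - u) (y - x)).trans
    (mul_le_mul_of_nonneg_left hyx (norm_nonneg _)))).1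
  rw [inner_sub_left] at hdiff
  linarith [h y hy]

theorem exists_finset_forall_le_inner_sub [FiniteDimensional ℝ E] {𝒜 : Set (Set E)} {x : E}
    (hA : ∀ u : E, ‖u‖ = 1 → ∃ A ∈ 𝒜, Bornology.IsBounded A ∧
      ∃ c > 0, ∀ y ∈ A, c ≤ inner ℝ u (y - x)) :
    ∃ s : Finset (Set E), ↑s ⊆ 𝒜 ∧ ∃ ρ > 0,
      ∀ u ∈ sphere (0 : E) 1, ∃ A ∈ s, ∀ y ∈ A, ρ ≤ inner ℝ u (y - x) := by
  classical
  refine (isCompact_sphere (0 : E) 1).induction_on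
    (p := fun U => ∃ s : Finset (Set E), ↑s ⊆ 𝒜 ∧ ∃ ρ > 0,
      ∀ u ∈ U, ∃ A ∈ s, ∀ y ∈ A, ρ ≤ inner ℝ u (y - x))
    ⟨∅, by simp, 1, one_pos, by simp⟩ ?_ ?_ ?_
  · exact fun U V hUV ⟨s, hs, ρ, hρ, h⟩ => ⟨s, hs, ρ, hρ, fun u hu => h u (hUV hu)⟩
  · rintro U V ⟨s, hs, ρ, hρ, hU⟩ ⟨t, ht, σ, hσ, hV⟩
    refine ⟨s ∪ t, by simp [hs, ht], min ρ σ, lt_min hρ hσ, fun u hu => ?_⟩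
    rcases hu with hu | hu
    · obtain ⟨A, hA, h⟩ := hU u hu
      exact ⟨A, Finset.mem_union_left t hA, fun y hy => (min_le_left _ _).trans (h y hy)⟩
    · obtain ⟨A, hA, h⟩ := hV u hu
      exact ⟨A, Finset.mem_union_right s hA, fun y hy => (min_le_right _ _).trans (h y hy)⟩
  · intro u hu
    obtain ⟨A, hA𝒜, hAb, c, hc, h⟩ := hA u (by simpa using hu)
    exact ⟨_, mem_nhdsWithin_of_mem_nhds (eventually_forall_le_inner_sub hAb (half_lt_self hc) h),
      {A}, by simpa using hA𝒜, c / 2, half_pos hc, fun v hv => ⟨A, by simp, hv⟩⟩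

theorem exists_isBallForcing [FiniteDimensional ℝ E] {𝒜 : Set (Set E)} (hne : 𝒜.Nonempty) {x : E}
    (hA : ∀ u : E, ‖u‖ = 1 → ∃ A ∈ 𝒜, Bornology.IsBounded A ∧
      ∃ c > 0, ∀ y ∈ A, c ≤ inner ℝ u (y - x)) :
    ∃ s : Finset (Set E), ↑s ⊆ 𝒜 ∧ ∃ ρ > 0, IsBallForcing s x ρ := by
  classical
  obtain ⟨s, hs𝒜, ρ, hρ, hs⟩ := exists_finset_forall_le_inner_sub hA
  obtain ⟨A₀, hA₀⟩ := hne
  refine ⟨insert A₀ s, by simp [Set.insert_subset_iff, hA₀, hs𝒜], ρ, hρ, fun C hC hmeet => ?_⟩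
  choose! y hy using hmeet
  refine (ball_subset_convexHull (Y := ↑((insert A₀ s).image y)) (Finset.finite_toSet _) (by simp)
    fun w hw => ?_).trans (convexHull_min ?_ hC)
  · obtain ⟨A, hA, h⟩ := hs w (by simpa using hw)
    have hA' := Finset.mem_insert_of_mem (b := A₀) hA
    exact ⟨y A, Finset.mem_coe.2 (Finset.mem_image_of_mem y hA'), h _ (hy A hA').2⟩
  · intro z hz
    obtain ⟨A, hA, rfl⟩ := Finset.mem_image.1 (Finset.mem_coe.1 hz)
    exact (hy A hA).1

end BallForcing

section Volume

variable {E : Type*} [NormedAddCommGroup E] [NormedSpace ℝ E] [MeasurableSpace E] [BorelSpace E]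
  {μ : Measure E} [μ.IsAddHaarMeasure] {f : E → ℝ} {x₀ z : E} {ρ l t m M : ℝ}

/-- Disjoint half-size balls are strung along the first half of the segment from the centre to the
distant point. -/
theorem nat_mul_measure_ball_le_of_convex {C : Set E} (hC : Convex ℝ C) (hρ : 0 < ρ)
    (hball : ball x₀ ρ ⊆ C) (hz : z ∈ C) {N : ℕ} (hN : 2 * N * ρ ≤ ‖z - x₀‖) :
    N * μ (ball 0 (ρ / 2)) ≤ μ C := by
  generalize hr : ‖z - x₀‖ = r at hN
  let lam (j : ℕ) : ℝ := 1 - j * ρ / r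
  let B (j : ℕ) : Set E := ball ((1 - lam j) • z + lam j • x₀) (ρ / 2)
  have hBC (j : ℕ) (hj : j ∈ Finset.range N) : B j ⊆ C := by
    have hjN : (j : ℝ) + 1 ≤ N := by exact_mod_cast Finset.mem_range.1 hj
    have hrpos : 0 < r := by nlinarith [(j.cast_nonneg : (0 : ℝ) ≤ j)]
    have hlam : 1 / 2 ≤ lam j := by
      rw [le_sub_comm, div_le_iff₀ hrpos]
      nlinarith
    have hlam1 : lam j ≤ 1 := sub_le_self _ (by positivity)
    exact (ball_subset_ball (by nlinarith)).trans
      (ball_convexCombo_subset hC hball hz (by linarith) hlam1)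
  have hdisj : Set.PairwiseDisjoint (Finset.range N) B := by
    intro i hi j _ hij
    have hrpos : 0 < r := by
      have hiN : (i : ℝ) + 1 ≤ N := by exact_mod_cast Finset.mem_range.1 (Finset.mem_coe.1 hi)
      nlinarith [(i.cast_nonneg : (0 : ℝ) ≤ i)]
    refine ball_disjoint_ball ?_
    have hsub : (1 - lam i) • z + lam i • x₀ - ((1 - lam j) • z + lam j • x₀) =
        (((i : ℝ) - j) * ρ / r) • (z - x₀) := by
      simp only [lam]; module
    have hone : (1 : ℝ) ≤ |(i : ℝ) - j| := by
      exact_mod_cast Int.one_le_abs (sub_ne_zero.2 (Nat.cast_injective.ne hij : (i : ℤ) ≠ j))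
    rw [dist_eq_norm, hsub, norm_smul, hr, Real.norm_eq_abs, abs_div, abs_mul, abs_of_pos hρ,
      abs_of_pos hrpos, div_mul_cancel₀ _ hrpos.ne', add_halves]
    exact le_mul_of_one_le_left hρ.le hone
  calc N * μ (ball 0 (ρ / 2)) = ∑ j ∈ Finset.range N, μ (B j) := by
        simp only [B, Measure.addHaar_ball_center, Finset.sum_const, Finset.card_range,
          nsmul_eq_mul]
    _ = μ (⋃ j ∈ Finset.range N, B j) :=
        (measure_biUnion_finset hdisj fun _ _ => measurableSet_ball).symm
    _ ≤ μ C := measure_mono (Set.iUnion₂_subset hBC)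

theorem mul_measure_le_lintegral_ofReal {α : Type*} [MeasurableSpace α] {ν : Measure α}
    {f : α → ℝ} (hf : Measurable f) (c : ℝ) {s : Set α} (h : ∀ x ∈ s, c ≤ f x) :
    ENNReal.ofReal c * ν s ≤ ∫⁻ x, ENNReal.ofReal (f x) ∂ν :=
  (mul_le_mul_right (measure_mono fun x hx => ENNReal.ofReal_le_ofReal (h x hx)) _).trans
    (mul_meas_ge_le_lintegral hf.ennreal_ofReal _)

/-- Bounds on a function in terms of finitely many parameters: at most `e^M` everywhere, and at
least `e^t` on a ball. Log-concave densities obeying common bounds have a common exponentially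
decaying envelope. -/
structure HasExpBounds (x₀ : E) (ρ t M : ℝ) (f : E → ℝ) : Prop where
  le_exp : ∀ x, f x ≤ Real.exp M
  exp_le : ∀ y ∈ ball x₀ ρ, Real.exp t ≤ f y

namespace LogConcave

variable (μ) in
/-- If `f` were large at a distant point, its superlevel set would have large volume. -/
theorem exists_radius_forall_le_exp (x₀ : E) (hρ : 0 < ρ) (t : ℝ) :
    ∃ R > 0, ∀ f : E → ℝ, LogConcave f → Measurable f → ∫⁻ x, ENNReal.ofReal (f x) ∂μ ≤ 1 →
      (∀ y ∈ ball x₀ ρ, Real.exp t ≤ f y) → ∀ z, R ≤ ‖z - x₀‖ → f z ≤ Real.exp (t - 1) := by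
  have hpos : ENNReal.ofReal (Real.exp (t - 1)) * μ (ball 0 (ρ / 2)) ≠ 0 :=
    mul_ne_zero (ENNReal.ofReal_pos.2 (Real.exp_pos _)).ne'
      (measure_ball_pos μ 0 (half_pos hρ)).ne'
  obtain ⟨N, hN⟩ := ENNReal.exists_nat_mul_gt hpos ENNReal.one_ne_top
  have hN0 : 0 < N := Nat.pos_of_ne_zero fun h => by simp [h] at hN
  refine ⟨2 * N * ρ, by positivity, fun f hf hfm hint hball z hz => ?_⟩
  by_contra! hlt
  have hvol : N * μ (ball 0 (ρ / 2)) ≤ μ {x | Real.exp (t - 1) ≤ f x} :=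
    nat_mul_measure_ball_le_of_convex (hf.convex_superlevel (Real.exp_pos _)) hρ
      (fun y hy => (Real.exp_le_exp.2 (sub_le_self t zero_le_one)).trans (hball y hy)) hlt.le hz
  refine hN.not_ge ?_
  calc N * (ENNReal.ofReal (Real.exp (t - 1)) * μ (ball 0 (ρ / 2)))
      = ENNReal.ofReal (Real.exp (t - 1)) * (N * μ (ball 0 (ρ / 2))) := by ring
    _ ≤ ENNReal.ofReal (Real.exp (t - 1)) * μ {x | Real.exp (t - 1) ≤ f x} := by gcongr
    _ ≤ 1 := (mul_measure_le_lintegral_ofReal hfm _ fun _ hx => hx).trans hint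

variable (μ) in
theorem exists_forall_le_exp_sub_norm (x₀ : E) (hρ : 0 < ρ) (t M : ℝ) :
    ∃ a b : ℝ, 0 < b ∧ ∀ f : E → ℝ, LogConcave f → Measurable f →
      ∫⁻ x, ENNReal.ofReal (f x) ∂μ ≤ 1 → HasExpBounds x₀ ρ t M f →
      ∀ x, f x ≤ Real.exp (a - b * ‖x‖) := by
  obtain ⟨R, hR, h⟩ := exists_radius_forall_le_exp μ x₀ hρ t
  exact ⟨_, 1 / R, by positivity, fun f hf hfm hint hb => hf.le_exp_sub_norm hR zero_le_one
    (hb.exp_le x₀ (mem_ball_self hρ))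
    (fun w hw => h f hf hfm hint hb.exp_le w (mem_sphere_iff_norm.1 hw).ge) hb.le_exp⟩

variable [FiniteDimensional ℝ E]

theorem combo_le_neg_log_measure_ball (hf : LogConcave f) (hfm : Measurable f)
    (hint : ∫⁻ x, ENNReal.ofReal (f x) ∂μ ≤ 1) (hρ : 0 < ρ)
    (hball : ∀ y ∈ ball x₀ ρ, Real.exp t ≤ f y) (hz : Real.exp m ≤ f z) (hl0 : 0 < l)
    (hl1 : l < 1) : (1 - l) * m + l * t ≤ -Real.log (μ.real (ball 0 (l * ρ))) := by
  have hle := (mul_measure_le_lintegral_ofReal hfm _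
    (hf.exp_le_on_ball hball hz hl0 hl1)).trans hint
  have hpos : 0 < μ.real (ball (0 : E) (l * ρ)) :=
    ENNReal.toReal_pos (measure_ball_pos μ 0 (mul_pos hl0 hρ)).ne' measure_ball_lt_top.ne
  rw [Measure.addHaar_ball_center] at hle
  have hle' := ENNReal.toReal_mono ENNReal.one_ne_top hle
  rw [ENNReal.toReal_mul, ENNReal.toReal_ofReal (Real.exp_pos _).le, ENNReal.toReal_one] at hle'
  rw [← Real.exp_le_exp, Real.exp_neg, Real.exp_log hpos, ← one_div]
  exact (le_div_iff₀ hpos).2 hle'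

/-- Otherwise all superlevel sets are convex with empty interior, hence null. -/
theorem exists_ball_exp_le (hf : LogConcave f) (hint : ∫⁻ x, ENNReal.ofReal (f x) ∂μ ≠ 0) :
    ∃ x₀ : E, ∃ ρ > 0, ∃ t : ℝ, ∀ y ∈ ball x₀ ρ, Real.exp t ≤ f y := by
  by_contra! hcon
  have hnull (n : ℕ) : μ {x | Real.exp (-n) ≤ f x} = 0 := by
    have hint : interior {x | Real.exp (-n) ≤ f x} = ∅ := by
      refine Set.eq_empty_of_forall_notMem fun x hx => ?_
      obtain ⟨ρ, hρ, hsub⟩ := Metric.isOpen_iff.1 isOpen_interior x hx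
      obtain ⟨y, hy, hlt⟩ := hcon x ρ hρ (-n)
      exact hlt.not_ge (interior_subset (hsub hy) : y ∈ {x | Real.exp (-n) ≤ f x})
    refine measure_mono_null ?_
      ((hf.convex_superlevel (Real.exp_pos (-n))).addHaar_frontier μ)
    rw [frontier, hint, Set.sdiff_empty]
    exact subset_closure
  refine hint (lintegral_eq_zero_of_ae_eq_zero ?_)
  refine measure_mono_null (fun x hx => ?_) (measure_iUnion_null hnull)
  have hfx : 0 < f x := by simpa using hx
  obtain ⟨n, hn⟩ := exists_nat_ge (-Real.log (f x))
  exact Set.mem_iUnion.2 ⟨n, (Real.le_log_iff_exp_le hfx).1 (neg_le.1 hn)⟩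

theorem exists_hasExpBounds (hf : LogConcave f) (hfm : Measurable f)
    (hint : ∫⁻ x, ENNReal.ofReal (f x) ∂μ = 1) :
    ∃ x₀ : E, ∃ ρ > 0, ∃ t M : ℝ, HasExpBounds x₀ ρ t M f := by
  obtain ⟨x₀, ρ, hρ, t, ht⟩ := hf.exists_ball_exp_le (hint.trans_ne one_ne_zero)
  refine ⟨x₀, ρ, hρ, t, 2 * (-Real.log (μ.real (ball 0 (1 / 2 * ρ)))) - t, fun z => ?_, ht⟩
  rcases (hf.nonneg z).eq_or_lt with hz | hz
  · exact hz.symm.trans_le (Real.exp_pos _).le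
  have := hf.combo_le_neg_log_measure_ball hfm hint.le hρ ht (Real.exp_log hz).le
    (l := 1 / 2) (by norm_num) (by norm_num)
  rw [← Real.log_le_iff_le_exp hz]
  linarith

end LogConcave

theorem exists_exp_sub_mul_le_mul_inv_pow (a : ℝ) {b : ℝ} (hb : 0 < b) (n : ℕ) :
    ∃ K : ℝ, ∀ u, 0 ≤ u → Real.exp (a - b * u) ≤ K * ((1 + u) ^ n)⁻¹ := by
  refine ⟨n.factorial * Real.exp (a + b) / b ^ n, fun u hu => ?_⟩
  have hexp : Real.exp (a - b * u) = Real.exp (a + b) * (Real.exp (b * (1 + u)))⁻¹ := by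
    rw [← Real.exp_neg, ← Real.exp_add]; ring_nf
  have hpow := Real.pow_div_factorial_le_exp (b * (1 + u)) (by positivity) n
  rw [hexp]
  calc _ ≤ Real.exp (a + b) * ((b * (1 + u)) ^ n / n.factorial)⁻¹ := by gcongr
    _ = _ := by rw [mul_pow]; field_simp

theorem lintegral_exp_sub_norm_lt_top [FiniteDimensional ℝ E] (μ : Measure E)
    [μ.IsAddHaarMeasure] (a : ℝ) {b : ℝ} (hb : 0 < b) :
    ∫⁻ x, ENNReal.ofReal (Real.exp (a - b * ‖x‖)) ∂μ < ⊤ := by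
  obtain ⟨K, hK⟩ := exists_exp_sub_mul_le_mul_inv_pow a hb (Module.finrank ℝ E + 1)
  have hint := ((integrable_one_add_norm (μ := μ) (E := E)
    (r := ((Module.finrank ℝ E + 1 : ℕ) : ℝ)) (by simp)).const_mul K).lintegral_lt_top
  refine (lintegral_mono fun x => ENNReal.ofReal_le_ofReal ?_).trans_lt hint
  refine (hK _ (norm_nonneg x)).trans_eq ?_
  rw [Real.rpow_neg (by positivity), Real.rpow_natCast]

end Volume

/-- The Euclidean space `ℝᵈ`. -/
abbrev Eucl (d : ℕ) : Type := EuclideanSpace ℝ (Fin d)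

theorem isConcave_logFun_iff {d : ℕ} {f : Eucl d → ℝ} (hf : ∀ x, 0 ≤ f x) :
    IsConcave (logFun f) ↔ LogConcave f := by
  have h : IsConcave (logFun f) ↔ ∀ x y, ∀ a b : ℝ, 0 < a → 0 < b → a + b = 1 →
      f x ^ a * f y ^ b ≤ f (a • x + b • y) := by
    unfold IsConcave logFun
    refine forall₂_congr fun x y => forall₂_congr fun a b => forall₃_congr fun ha hb _ => ?_
    rw [← ENNReal.log_rpow, ← ENNReal.log_rpow, ← ENNReal.log_mul_add, ENNReal.log_le_log_iff,
      ENNReal.ofReal_rpow_of_nonneg (hf x) ha.le, ENNReal.ofReal_rpow_of_nonneg (hf y) hb.le,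
      ← ENNReal.ofReal_mul (Real.rpow_nonneg (hf x) a), ENNReal.ofReal_le_ofReal_iff (hf _)]
  exact h.trans ⟨fun h => ⟨hf, h⟩, fun h => h.rpow_mul_rpow_le⟩

namespace IsLogConcaveDensity

variable {d : ℕ} {f : Eucl d → ℝ}

theorem of_logConcave (hf : LogConcave f) (husc : UpperSemicontinuous f)
    (hint : ∫⁻ x, ENNReal.ofReal (f x) = 1) : IsLogConcaveDensity f :=
  ⟨hf.nonneg, husc, (isConcave_logFun_iff hf.nonneg).2 hf, hint⟩

theorem logConcave (hf : IsLogConcaveDensity f) : LogConcave f :=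
  (isConcave_logFun_iff hf.nonneg).1 hf.concave_log

theorem measurable (hf : IsLogConcaveDensity f) : Measurable f := hf.usc.measurable

theorem exists_hasExpBounds (hf : IsLogConcaveDensity f) :
    ∃ x₀ : Eucl d, ∃ ρ > 0, ∃ t M : ℝ, HasExpBounds x₀ ρ t M f :=
  hf.logConcave.exists_hasExpBounds hf.measurable hf.lintegral_eq_one

theorem exists_le_exp_sub_norm (hf : IsLogConcaveDensity f) :
    ∃ a b : ℝ, 0 < b ∧ ∀ x, f x ≤ Real.exp (a - b * ‖x‖) := by
  obtain ⟨x₀, ρ, hρ, t, M, hbounds⟩ := hf.exists_hasExpBounds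
  obtain ⟨a, b, hb, h⟩ := LogConcave.exists_forall_le_exp_sub_norm volume x₀ hρ t M
  exact ⟨a, b, hb, h f hf.logConcave hf.measurable hf.lintegral_eq_one.le hbounds⟩

end IsLogConcaveDensity

section LogDeficit

/-- The amount `M - log t ∈ [0,∞]` by which `log t` falls short of the upper bound `M`; it is `∞`
at `t = 0`. It turns log-likelihoods into integrals of nonnegative functions. -/
noncomputable def logDeficit (M t : ℝ) : ENNReal :=
  ((M : EReal) - ENNReal.log (ENNReal.ofReal t)).toENNReal

variable {M t : ℝ}

theorem logDeficit_of_nonpos (ht : t ≤ 0) : logDeficit M t = ⊤ := by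
  simp [logDeficit, ENNReal.ofReal_of_nonpos ht]

theorem logDeficit_of_pos (ht : 0 < t) : logDeficit M t = ENNReal.ofReal (M - Real.log t) := by
  rw [logDeficit, ENNReal.log_ofReal_of_pos ht, ← EReal.coe_sub, EReal.real_coe_toENNReal]

theorem logDeficit_exp (s : ℝ) : logDeficit M (Real.exp s) = ENNReal.ofReal (M - s) := by
  rw [logDeficit_of_pos (Real.exp_pos s), Real.log_exp]

theorem lt_logDeficit_iff {c : ENNReal} (hc : c ≠ ⊤) :
    c < logDeficit M t ↔ t < Real.exp (M - c.toReal) := by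
  rcases le_or_gt t 0 with ht | ht
  · rw [logDeficit_of_nonpos ht]
    exact iff_of_true hc.lt_top (ht.trans_lt (Real.exp_pos _))
  · rw [logDeficit_of_pos ht, ENNReal.lt_ofReal_iff_toReal_lt hc, ← Real.log_lt_iff_lt_exp ht,
      lt_sub_comm]

theorem antitone_logDeficit (M : ℝ) : Antitone (logDeficit M) := fun _ _ hst =>
  EReal.toENNReal_le_toENNReal
    (EReal.sub_le_sub le_rfl (ENNReal.log_le_log (ENNReal.ofReal_le_ofReal hst)))

theorem measurable_logDeficit (M : ℝ) : Measurable (logDeficit M) :=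
  (antitone_logDeficit M).measurable

end LogDeficit

section ExtIntegral

theorem toENNReal_add_toENNReal_sub {M : ℝ} {z : EReal} (hz : z ≤ M) :
    z.toENNReal + ((M - z).toENNReal + ENNReal.ofReal (-M)) =
      ENNReal.ofReal M + (-z).toENNReal := by
  induction z with
  | bot => simp
  | top => simp at hz
  | coe x =>
    have hx : x ≤ M := EReal.coe_le_coe_iff.1 hz
    rw [← EReal.coe_sub, ← EReal.coe_neg, EReal.real_coe_toENNReal, EReal.real_coe_toENNReal,
      EReal.real_coe_toENNReal, ← ENNReal.toReal_eq_toReal_iff' (by finiteness) (by finiteness)]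
    rw [ENNReal.toReal_add (by finiteness) (by finiteness), ENNReal.toReal_add (by finiteness)
      (by finiteness), ENNReal.toReal_add (by finiteness) (by finiteness)]
    simp only [ENNReal.toReal_ofReal']
    rw [max_eq_left (sub_nonneg.2 hx)]
    linarith [max_zero_sub_max_neg_zero_eq_self M, max_zero_sub_max_neg_zero_eq_self x]

theorem coe_sub_coe_eq_of_add_eq {M : ℝ} {p q J : ENNReal} (hp : p ≠ ⊤)
    (h : p + (J + ENNReal.ofReal (-M)) = ENNReal.ofReal M + q) : (p : EReal) - q = M - J := by
  lift p to NNReal using hp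
  rcases eq_or_ne J ⊤ with rfl | hJ
  · have hq : q = ⊤ := by simpa using h.symm
    simp [hq]
  · have hq : q ≠ ⊤ := by
      rintro rfl
      rw [add_top] at h
      exact ENNReal.add_ne_top.2 ⟨ENNReal.coe_ne_top, by finiteness⟩ h
    have hr := congrArg ENNReal.toReal h
    rw [ENNReal.toReal_add (by finiteness) (by finiteness), ENNReal.toReal_add hJ (by finiteness),
      ENNReal.toReal_add (by finiteness) hq, ENNReal.toReal_ofReal', ENNReal.toReal_ofReal'] at hr
    rw [← EReal.coe_ennreal_toReal ENNReal.coe_ne_top, ← EReal.coe_ennreal_toReal hJ,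
      ← EReal.coe_ennreal_toReal hq, ← EReal.coe_sub, ← EReal.coe_sub, EReal.coe_eq_coe_iff]
    linarith [max_zero_sub_max_neg_zero_eq_self M]

variable {d : ℕ} {f : Eucl d → ℝ} {M : ℝ} (P : Measure (Eucl d)) [IsProbabilityMeasure P]

theorem extIntegral_eq_sub_lintegral {φ : Eucl d → EReal} (hφ : Measurable φ)
    (hM : ∀ x, φ x ≤ M) :
    extIntegral φ P = M - ((∫⁻ x, (M - φ x).toENNReal ∂P : ENNReal) : EReal) := by
  have hint := lintegral_congr (μ := P) fun x => toENNReal_add_toENNReal_sub (hM x)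
  rw [lintegral_add_left hφ.ereal_toENNReal, lintegral_add_right _ measurable_const,
    lintegral_add_left measurable_const, lintegral_const, lintegral_const, measure_univ,
    mul_one, mul_one] at hint
  refine coe_sub_coe_eq_of_add_eq (ne_top_of_le_ne_top
    (b := ENNReal.ofReal M) ENNReal.ofReal_ne_top ?_) hint
  calc ∫⁻ x, (φ x).toENNReal ∂P ≤ ∫⁻ _, ENNReal.ofReal M ∂P :=
        lintegral_mono fun x => EReal.toENNReal_le_toENNReal (hM x)
    _ = ENNReal.ofReal M := by simp

theorem logFun_le_coe_iff {x : Eucl d} : logFun f x ≤ M ↔ f x ≤ Real.exp M := by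
  rw [logFun, ← Real.log_exp M, ← ENNReal.log_ofReal_of_pos (Real.exp_pos M),
    ENNReal.log_le_log_iff, Real.log_exp, ENNReal.ofReal_le_ofReal_iff (Real.exp_pos M).le]

theorem extIntegral_logFun_eq (hf : Measurable f) (hM : ∀ x, f x ≤ Real.exp M) :
    extIntegral (logFun f) P = M - ((∫⁻ x, logDeficit M (f x) ∂P : ENNReal) : EReal) :=
  extIntegral_eq_sub_lintegral P (ENNReal.measurable_log.comp hf.ennreal_ofReal)
    fun x => logFun_le_coe_iff.2 (hM x)

theorem coe_le_coe_sub_coe_iff {c M : ℝ} {J : ENNReal} :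
    (c : EReal) ≤ M - J ↔ c ≤ M ∧ J ≤ ENNReal.ofReal (M - c) := by
  rcases eq_or_ne J ⊤ with rfl | hJ
  · simp
  rw [← EReal.coe_ennreal_toReal hJ, ← EReal.coe_sub, EReal.coe_le_coe_iff, le_sub_comm]
  constructor
  · intro h
    have hcM : 0 ≤ M - c := ENNReal.toReal_nonneg.trans h
    exact ⟨sub_nonneg.1 hcM, (ENNReal.le_ofReal_iff_toReal_le hJ hcM).2 h⟩
  · rintro ⟨hcM, h⟩
    exact (ENNReal.le_ofReal_iff_toReal_le hJ (sub_nonneg.2 hcM)).1 h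

theorem coe_le_extIntegral_logFun_iff (hf : Measurable f) (hM : ∀ x, f x ≤ Real.exp M) {c : ℝ} :
    (c : EReal) ≤ extIntegral (logFun f) P ↔
      c ≤ M ∧ ∫⁻ x, logDeficit M (f x) ∂P ≤ ENNReal.ofReal (M - c) := by
  rw [extIntegral_logFun_eq P hf hM, coe_le_coe_sub_coe_iff]

theorem measure_compl_superlevel_le (hf : Measurable f) (hM : ∀ x, f x ≤ Real.exp M)
    {c t : ℝ} (ht : t < M) (hc : (c : EReal) ≤ extIntegral (logFun f) P) :
    P {x | Real.exp t ≤ f x}ᶜ ≤ ENNReal.ofReal ((M - c) / (M - t)) := by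
  have hsub : {x | Real.exp t ≤ f x}ᶜ ⊆ {x | ENNReal.ofReal (M - t) ≤ logDeficit M (f x)} :=
    fun x hx => by
      have hlt : f x < Real.exp t := not_le.1 hx
      exact (logDeficit_exp t).symm.trans_le (antitone_logDeficit M hlt.le)
  rw [ENNReal.ofReal_div_of_pos (sub_pos.2 ht)]
  calc P {x | Real.exp t ≤ f x}ᶜ ≤ P {x | ENNReal.ofReal (M - t) ≤ logDeficit M (f x)} :=
        measure_mono hsub
    _ ≤ (∫⁻ x, logDeficit M (f x) ∂P) / ENNReal.ofReal (M - t) :=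
        meas_ge_le_lintegral_div ((measurable_logDeficit M).comp hf).aemeasurable
          (ENNReal.ofReal_pos.2 (sub_pos.2 ht)).ne' ENNReal.ofReal_ne_top
    _ ≤ ENNReal.ofReal (M - c) / ENNReal.ofReal (M - t) :=
        ENNReal.div_le_div_right ((coe_le_extIntegral_logFun_iff P hf hM).1 hc).2 _

end ExtIntegral

section LikelihoodBounds

variable {d : ℕ} {f : Eucl d → ℝ} {P : Measure (Eucl d)} {s : Finset (Set (Eucl d))}
  {x₀ : Eucl d} {ρ η c M : ℝ}

theorem exp_le_on_ball_of_le_extIntegral [IsProbabilityMeasure P]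
    (hs : IsBallForcing s x₀ ρ) (hη : 0 < η) (hPs : ∀ A ∈ s, ENNReal.ofReal η ≤ P A)
    (hf : LogConcave f) (hfm : Measurable f) (hM : ∀ x, f x ≤ Real.exp M)
    (hc : (c : EReal) ≤ extIntegral (logFun f) P) {K : ℝ} (hK : M - c < K) :
    ∀ y ∈ ball x₀ ρ, Real.exp (M - K / η) ≤ f y := by
  have hcM : c ≤ M := ((coe_le_extIntegral_logFun_iff P hfm hM).1 hc).1
  have hKpos : 0 < K := (sub_nonneg.2 hcM).trans_lt hK
  have hKη : 0 < K / η := div_pos hKpos hη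
  refine hs {x | Real.exp (M - K / η) ≤ f x} (hf.convex_superlevel (Real.exp_pos _))
    fun A hA => Set.not_disjoint_iff_nonempty_inter.1 fun hdisj => ?_
  have hle : ENNReal.ofReal η ≤ ENNReal.ofReal ((M - c) / (M - (M - K / η))) :=
    ((hPs A hA).trans (measure_mono hdisj.subset_compl_left)).trans
      (measure_compl_superlevel_le P hfm hM (sub_lt_self M hKη) hc)
  refine hle.not_gt ((ENNReal.ofReal_lt_ofReal_iff hη).2 ?_)
  rwa [sub_sub_cancel, div_lt_iff₀ hKη, mul_div_cancel₀ _ hη.ne']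

theorem exists_le_exp_and_exp_lt {α : Type*} {f : α → ℝ} (hf : BddAbove (Set.range f)) {w : α}
    (hw : 0 < f w) : ∃ M, (∀ x, f x ≤ Real.exp M) ∧ ∃ z, Real.exp (M - 1) < f z := by
  have hpos : 0 < ⨆ x, f x := hw.trans_le (le_ciSup hf w)
  have : Nonempty α := ⟨w⟩
  refine ⟨Real.log (⨆ x, f x), fun x => ?_, exists_lt_of_lt_ciSup ?_⟩
  · rw [Real.exp_log hpos]; exact le_ciSup hf x
  · rw [← Real.lt_log_iff_exp_lt hpos]; exact sub_one_lt _

/-- If `e^M` is nearly the maximum, the likelihood bound makes `f` at least `e^(M - (M+|c|+1)/η)` on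
the ball, and then unit mass rules out a large `M`. -/
theorem exists_hasExpBounds_of_le_extIntegral (hs : IsBallForcing s x₀ ρ) (hρ : 0 < ρ)
    (hη : 0 < η) (hη1 : η < 1) (c : ℝ) :
    ∃ t M : ℝ, ∀ P : Measure (Eucl d), IsProbabilityMeasure P →
      (∀ A ∈ s, ENNReal.ofReal η ≤ P A) → ∀ f : Eucl d → ℝ, IsLogConcaveDensity f →
      (c : EReal) ≤ extIntegral (logFun f) P → HasExpBounds x₀ ρ t M f := by
  obtain ⟨V, hV⟩ : ∃ V, V = -Real.log (volume.real (ball (0 : Eucl d) (η / 2 * ρ))) := ⟨_, rfl⟩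
  obtain ⟨B, hB0, hBV⟩ : ∃ B, 0 ≤ B ∧ 2 * V + |c| + 3 ≤ B :=
    ⟨max 0 (2 * V + |c| + 3), le_max_left _ _, le_max_right _ _⟩
  refine ⟨c - (B + |c| + 1) / η, B, fun P _ hPs f hf hc => ?_⟩
  obtain ⟨w, r, hr, t₁, M₁, hb₁⟩ := hf.exists_hasExpBounds
  obtain ⟨M, hM, z, hz⟩ := exists_le_exp_and_exp_lt
    ⟨Real.exp M₁, Set.forall_mem_range.2 hb₁.le_exp⟩
    ((Real.exp_pos t₁).trans_le (hb₁.exp_le w (mem_ball_self hr)))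
  have hcM : c ≤ M := ((coe_le_extIntegral_logFun_iff P hf.measurable hM).1 hc).1
  have hball := exp_le_on_ball_of_le_extIntegral hs hη hPs hf.logConcave hf.measurable hM hc
    (K := max 0 M + |c| + 1) (by linarith [le_max_right 0 M, neg_abs_le c])
  have hMB : M ≤ B := by
    have hcombo := hf.logConcave.combo_le_neg_log_measure_ball hf.measurable
      hf.lintegral_eq_one.le hρ hball hz.le (half_pos hη) (by linarith)
    rw [← hV, show (1 - η / 2) * (M - 1) + η / 2 * (M - (max 0 M + |c| + 1) / η) =
      M - 1 + η / 2 - (max 0 M + |c| + 1) / 2 by field_simp; ring] at hcombo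
    rcases le_total M 0 with h | h
    · exact h.trans hB0
    · rw [max_eq_right h] at hcombo
      linarith
  refine ⟨fun x => (hM x).trans (Real.exp_le_exp.2 hMB), fun y hy =>
    (Real.exp_le_exp.2 ?_).trans (hball y hy)⟩
  have : (max 0 M + |c| + 1) / η ≤ (B + |c| + 1) / η := by gcongr; exact max_le hB0 hMB
  linarith

end LikelihoodBounds

section MassPosition

variable {E : Type*} [NormedAddCommGroup E] [InnerProductSpace ℝ E] [MeasurableSpace E]
  {P : Measure E} {s : Finset (Set E)} {x₀ : E} {ρ : ℝ}

theorem measure_inner_sub_integral_pos [CompleteSpace E] [IsProbabilityMeasure P]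
    (hint : Integrable (fun y => y) P) {u : E}
    (hu : P {y | inner ℝ u y = inner ℝ u (∫ z, z ∂P)} < 1) :
    0 < P {y | 0 < inner ℝ u (y - ∫ z, z ∂P)} := by
  by_contra! hnull
  have hle : ∀ᵐ y ∂P, inner ℝ u y ≤ inner ℝ u (∫ z, z ∂P) := by
    refine ae_iff.2 (measure_mono_null (fun y hy => ?_) (nonpos_iff_eq_zero.1 hnull))
    rw [Set.mem_ofPred_eq, inner_sub_right]
    exact sub_pos.2 (not_le.1 hy)
  have hae : ∀ᵐ y ∂P, inner ℝ u y = inner ℝ u (∫ z, z ∂P) :=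
    (integral_eq_iff_of_ae_le (hint.const_inner u) (integrable_const _) hle).1 (by
      simp [integral_inner hint])
  rw [measure_congr (eventuallyEq_univ.2 hae), measure_univ] at hu
  exact lt_irrefl _ hu

theorem exists_isOpen_isBounded_of_measure_inner_pos {u x : E}
    (h : 0 < P {y | 0 < inner ℝ u (y - x)}) :
    ∃ A, (IsOpen A ∧ 0 < P A) ∧ Bornology.IsBounded A ∧
      ∃ c > 0, ∀ y ∈ A, c ≤ inner ℝ u (y - x) := by
  have hcover : {y | 0 < inner ℝ u (y - x)} ⊆
      ⋃ n : ℕ, {y | 1 / ((n : ℝ) + 1) < inner ℝ u (y - x)} ∩ ball x n := fun y hy => by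
    obtain ⟨n, hn⟩ := exists_nat_one_div_lt (Set.mem_ofPred.1 hy)
    obtain ⟨m, hm⟩ := exists_nat_gt (dist y x)
    refine Set.mem_iUnion.2 ⟨max n m, hn.trans_le' ?_, hm.trans_le ?_⟩
    · gcongr
      exact le_max_left _ _
    · exact_mod_cast le_max_right _ _
  obtain ⟨n, hn⟩ := exists_measure_pos_of_not_measure_iUnion_null
    (h.trans_le (measure_mono hcover)).ne'
  exact ⟨_, ⟨(isOpen_lt continuous_const (by fun_prop)).inter isOpen_ball, hn⟩,
    isBounded_ball.subset Set.inter_subset_right, _, Nat.one_div_pos_of_nat,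
    fun _ hy => hy.1.le⟩

theorem IsBallForcing.ball_subset_of_measure_compl_eq_zero (hs : IsBallForcing s x₀ ρ)
    (hpos : ∀ A ∈ s, 0 < P A) {C : Set E} (hC : Convex ℝ C) (hPC : P Cᶜ = 0) : ball x₀ ρ ⊆ C :=
  hs C hC fun A hA => Set.not_disjoint_iff_nonempty_inter.1 fun hdisj =>
    (hpos A hA).ne' (measure_mono_null hdisj.subset_compl_left hPC)

variable {d : ℕ} {P : Measure (Eucl d)} {s : Finset (Set (Eucl d))} {x₀ : Eucl d}

/-- The ball is centred at the mean, as every open half-space bounded by a hyperplane through the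
mean has positive mass. -/
theorem InClassP.exists_isBallForcing (hP : InClassP P) :
    ∃ (s : Finset (Set (Eucl d))) (x₀ : Eucl d) (ρ : ℝ), 0 < ρ ∧
      (∀ A ∈ s, IsOpen A ∧ 0 < P A) ∧ IsBallForcing s x₀ ρ := by
  have := hP.isProbabilityMeasure
  have hint : Integrable (fun y : Eucl d => y) P :=
    ⟨measurable_id.aestronglyMeasurable, hasFiniteIntegral_iff_norm _ |>.2 hP.finite_mean⟩
  obtain ⟨s, hs𝒜, ρ, hρ, hs⟩ := LogConcaveMLE.exists_isBallForcing
    (𝒜 := {A : Set (Eucl d) | IsOpen A ∧ 0 < P A}) ⟨Set.univ, isOpen_univ, by simp⟩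
    fun u hu => exists_isOpen_isBounded_of_measure_inner_pos
      (measure_inner_sub_integral_pos hint
        (hP.hyperplane_lt_one u (norm_pos_iff.1 (hu ▸ one_pos)) _))
  exact ⟨s, _, ρ, hρ, hs𝒜, hs⟩

theorem InClassP.exists_ball_subset (hP : InClassP P) {C : Set (Eucl d)} (hC : Convex ℝ C)
    (hPC : P Cᶜ = 0) : ∃ x₀, ∃ ρ > 0, ball x₀ ρ ⊆ C := by
  obtain ⟨s, x₀, ρ, hρ, hpos, hs⟩ := hP.exists_isBallForcing
  exact ⟨x₀, ρ, hρ, hs.ball_subset_of_measure_compl_eq_zero (fun A hA => (hpos A hA).2) hC hPC⟩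

theorem not_ball_subset_hyperplane {F : Type*} [NormedAddCommGroup F] [InnerProductSpace ℝ F]
    {v : F} (hv : v ≠ 0) (c : ℝ) (x : F) {ρ : ℝ} (hρ : 0 < ρ) :
    ¬ ball x ρ ⊆ {y | inner ℝ v y = c} := fun hball => by
  have hvn : ‖v‖ ≠ 0 := norm_ne_zero_iff.2 hv
  have hx : inner ℝ v x = c := hball (mem_ball_self hρ)
  have hxv : inner ℝ v (x + (ρ / (2 * ‖v‖)) • v) = c := hball (by
    rw [mem_ball_iff_norm, add_sub_cancel_left, norm_smul, Real.norm_of_nonneg (by positivity)]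
    field_simp
    linarith)
  rw [inner_add_right, hx, real_inner_smul_right, real_inner_self_eq_norm_sq] at hxv
  exact (by positivity : ρ / (2 * ‖v‖) * ‖v‖ ^ 2 ≠ 0) (by linarith)

theorem IsBallForcing.inClassP [IsProbabilityMeasure P] (hs : IsBallForcing s x₀ ρ) (hρ : 0 < ρ)
    (hpos : ∀ A ∈ s, 0 < P A) (hmean : ∫⁻ x, ENNReal.ofReal ‖x‖ ∂P < ⊤) : InClassP P := by
  refine ⟨inferInstance, hmean, fun v hv c => prob_le_one.lt_of_ne fun hone => ?_⟩
  have hmeas : MeasurableSet {x : Eucl d | inner ℝ v x = c} :=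
    measurableSet_eq_fun (by fun_prop) measurable_const
  exact not_ball_subset_hyperplane hv c x₀ hρ
    (hs.ball_subset_of_measure_compl_eq_zero hpos
      (convex_hyperplane (innerₗ _ v).isLinear c) ((prob_compl_eq_zero_iff hmeas).2 hone))

end MassPosition

section HypoTendsto

/-- Convergence of the hypographs of `F k` to that of `f` (Painlevé–Kuratowski), along a filter of
indices: it makes `f` upper semicontinuous and, for log-concave functions, is stronger than almost
everywhere convergence, while bounded sequences have convergent subsequences. -/
structure HypoTendsto {ι X Y : Type*} [TopologicalSpace X] [LT Y] (l : Filter ι) (F : ι → X → Y)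
    (f : X → Y) : Prop where
  upper : ∀ x c, f x < c → ∃ U ∈ 𝓝 x, ∀ᶠ k in l, ∀ y ∈ U, F k y < c
  lower : ∀ x c, c < f x → ∀ U ∈ 𝓝 x, ∀ᶠ k in l, ∃ y ∈ U, c < F k y

variable {ι X Y : Type*} [TopologicalSpace X] {l : Filter ι}

theorem hypoTendsto_iInf_of_tendsto_iSup [CompleteLinearOrder Y] [TopologicalSpace Y]
    [OrderTopology Y] {F : ι → X → Y} {b : Set (Set X)} (hb : TopologicalSpace.IsTopologicalBasis b)
    {S : Set X → Y} (hS : ∀ U ∈ b, Tendsto (fun k => ⨆ y ∈ U, F k y) l (𝓝 (S U))) :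
    HypoTendsto l F fun x => ⨅ U ∈ {U ∈ b | x ∈ U}, S U where
  upper x c hc := by
    simp only [iInf_lt_iff] at hc
    obtain ⟨U, ⟨hU, hxU⟩, hSU⟩ := hc
    exact ⟨U, hb.mem_nhds hU hxU, ((hS U hU).eventually_lt_const hSU).mono fun k hk y hy =>
      (le_iSup₂ (f := fun y _ => F k y) y hy).trans_lt hk⟩
  lower x c hc U hU := by
    obtain ⟨V, hV, hxV, hVU⟩ := hb.mem_nhds_iff.1 hU
    have hSV : c < S V := hc.trans_le (iInf₂_le V ⟨hV, hxV⟩)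
    refine ((hS V hV).eventually_const_lt hSV).mono fun k hk => ?_
    simp only [lt_iSup_iff] at hk
    obtain ⟨y, hy, hlt⟩ := hk
    exact ⟨y, hVU hy, hlt⟩

theorem exists_subseq_hypoTendsto [SecondCountableTopology X] [CompleteLinearOrder Y]
    [TopologicalSpace Y] [OrderTopology Y] [FirstCountableTopology Y] (F : ℕ → X → Y) :
    ∃ φ : ℕ → ℕ, StrictMono φ ∧ ∃ f, HypoTendsto atTop (fun k => F (φ k)) f := by
  have hcount := TopologicalSpace.countable_countableBasis X
  have : Countable (TopologicalSpace.countableBasis X) := hcount.to_subtype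
  obtain ⟨S, φ, hφ, hS⟩ := CompactSpace.tendsto_subseq
    fun k (U : TopologicalSpace.countableBasis X) => ⨆ y ∈ (U : Set X), F k y
  classical
  refine ⟨φ, hφ, _, hypoTendsto_iInf_of_tendsto_iSup (TopologicalSpace.isBasis_countableBasis X)
    (S := fun U => if hU : U ∈ TopologicalSpace.countableBasis X then S ⟨U, hU⟩ else ⊤)
    fun U hU => ?_⟩
  rw [dif_pos hU]
  exact tendsto_pi_nhds.1 hS ⟨U, hU⟩

namespace HypoTendsto

section LinearOrder

variable [LinearOrder Y] {F : ι → X → Y} {f : X → Y} {x : X} {c : Y}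

theorem eventually_lt (h : HypoTendsto l F f) (hc : f x < c) : ∀ᶠ k in l, F k x < c := by
  obtain ⟨U, hU, hlt⟩ := h.upper x c hc
  exact hlt.mono fun k hk => hk x (mem_of_mem_nhds hU)

theorem eventually_forall_lt_of_isCompact (h : HypoTendsto l F f) {K : Set X} (hK : IsCompact K)
    (hc : ∀ x ∈ K, f x < c) : ∀ᶠ k in l, ∀ x ∈ K, F k x < c := by
  refine hK.induction_on (p := fun s => ∀ᶠ k in l, ∀ x ∈ s, F k x < c) (by simp)
    (fun s t hst ht => ht.mono fun k hk x hx => hk x (hst hx))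
    (fun s t hs ht => (hs.and ht).mono fun k hk x hx => hx.elim (hk.1 x) (hk.2 x))
    fun x hx => ?_
  obtain ⟨U, hU, hlt⟩ := h.upper x c (hc x hx)
  exact ⟨U, mem_nhdsWithin_of_mem_nhds hU, hlt⟩

theorem upperSemicontinuous [DenselyOrdered Y] [l.NeBot] (h : HypoTendsto l F f) :
    UpperSemicontinuous f := by
  intro x c hc
  obtain ⟨c', hc', hcc'⟩ := exists_between hc
  obtain ⟨U, hU, hlt⟩ := h.upper x c' hc'
  filter_upwards [eventually_mem_nhds_iff.2 hU] with y hy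
  by_contra! hle
  obtain ⟨k, hk, z, hz, hz'⟩ := (hlt.and (h.lower y c' (hcc'.trans_le hle) U hy)).exists
  exact lt_asymm hz' (hk z hz)

theorem le_apply [l.NeBot] (h : HypoTendsto l F f) (hF : ∀ᶠ k in l, c ≤ F k x) : c ≤ f x := by
  by_contra! hlt
  obtain ⟨k, hk, hk'⟩ := (hF.and (h.eventually_lt hlt)).exists
  exact hk'.not_ge hk

theorem apply_le [l.NeBot] (h : HypoTendsto l F f) (hF : ∀ᶠ k in l, ∀ y, F k y ≤ c) : f x ≤ c := by
  by_contra! hlt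
  obtain ⟨k, hk, y, -, hy⟩ := (hF.and (h.lower x c hlt _ univ_mem)).exists
  exact hy.not_ge (hk y)

end LinearOrder

variable {F : ι → X → ℝ} {f : X → ℝ}

theorem of_coe_ereal (h : HypoTendsto l (fun k x => (F k x : EReal)) fun x => (f x : EReal)) :
    HypoTendsto l F f where
  upper x c hc := by exact_mod_cast h.upper x c (EReal.coe_lt_coe_iff.2 hc)
  lower x c hc := by exact_mod_cast h.lower x c (EReal.coe_lt_coe_iff.2 hc)

end HypoTendsto

theorem exists_subseq_hypoTendsto_of_mem_Icc [SecondCountableTopology X] {F : ℕ → X → ℝ} {a b : ℝ}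
    (hF : ∀ k x, F k x ∈ Set.Icc a b) :
    ∃ φ : ℕ → ℕ, StrictMono φ ∧ ∃ f, HypoTendsto atTop (fun k => F (φ k)) f := by
  obtain ⟨φ, hφ, g, hg⟩ := exists_subseq_hypoTendsto fun k x => (F k x : EReal)
  lift g to X → ℝ using fun x =>
    ⟨((EReal.coe_lt_top b).trans_le' (hg.apply_le (Eventually.of_forall fun k y =>
        EReal.coe_le_coe_iff.2 (hF (φ k) y).2))).ne,
      ((EReal.bot_lt_coe a).trans_le (hg.le_apply (Eventually.of_forall fun k =>
        EReal.coe_le_coe_iff.2 (hF (φ k) x).1))).ne'⟩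
  exact ⟨φ, hφ, g, hg.of_coe_ereal⟩

end HypoTendsto

section HypoTendstoLogConcave

theorem exists_isBallForcing_of_mem_nhds {E : Type*} [NormedAddCommGroup E] [InnerProductSpace ℝ E]
    [FiniteDimensional ℝ E] {x : E} {U : Set E} (hU : U ∈ 𝓝 x) :
    ∃ s : Finset (Set E), (∀ A ∈ s, A ⊆ U ∧ ∃ y, A ∈ 𝓝 y) ∧ ∃ ρ > 0, IsBallForcing s x ρ := by
  obtain ⟨r, hr, hrU⟩ := nhds_basis_ball.mem_iff.1 hU
  obtain ⟨s, hsU, ρ, hρ, hs⟩ := exists_isBallForcing (𝒜 := {A : Set E | A ⊆ U ∧ ∃ y, A ∈ 𝓝 y})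
    (x := x) ⟨U, subset_rfl, x, hU⟩ fun u hu => by
      have hnorm : ‖(r / 2) • u‖ = r / 2 := by
        rw [norm_smul, hu, mul_one, Real.norm_of_nonneg (by positivity)]
      refine ⟨ball (x + (r / 2) • u) (r / 4), ⟨(ball_subset_ball' ?_).trans hrU, _,
        ball_mem_nhds _ (by positivity)⟩, isBounded_ball, r / 4, by positivity, fun y hy => ?_⟩
      · rw [dist_eq_norm, add_sub_cancel_left, hnorm]
        linarith
      · rw [mem_ball_iff_norm] at hy
        have hsplit : y - x = (y - (x + (r / 2) • u)) + (r / 2) • u := by abel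
        rw [hsplit, inner_add_right, real_inner_smul_right, real_inner_self_eq_norm_sq, hu]
        have := (abs_le.1 (abs_real_inner_le_norm u (y - (x + (r / 2) • u)))).1
        rw [hu] at this
        linarith
  exact ⟨s, hsU, ρ, hρ, hs⟩

namespace HypoTendsto

variable {ι E : Type*} [NormedAddCommGroup E] {l : Filter ι} {F : ι → E → ℝ} {f : E → ℝ}

theorem rpow_mul_rpow_le_of_lt [NormedSpace ℝ E] [l.NeBot] (h : HypoTendsto l F f)
    (hF : ∀ᶠ k in l, LogConcave (F k)) {x y : E} {a b p q : ℝ} (ha : 0 < a) (hb : 0 < b)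
    (hab : a + b = 1) (hp : 0 < p) (hq : 0 < q) (hpx : p < f x) (hqy : q < f y) :
    p ^ a * q ^ b ≤ f (a • x + b • y) := by
  by_contra! hlt
  obtain ⟨W, hW, hWlt⟩ := h.upper _ _ hlt
  have hcont : Tendsto (fun z : E × E => a • z.1 + b • z.2) (𝓝 x ×ˢ 𝓝 y) (𝓝 (a • x + b • y)) := by
    rw [← nhds_prod_eq]
    exact Continuous.tendsto (by fun_prop) (x, y)
  obtain ⟨U, hU, V, hV, hUV⟩ := mem_prod_iff.1 (hcont hW)
  obtain ⟨k, ⟨hk, hkW⟩, ⟨x', hx', hpx'⟩, y', hy', hqy'⟩ :=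
    ((hF.and hWlt).and ((h.lower x p hpx U hU).and (h.lower y q hqy V hV))).exists
  exact (hkW _ (hUV (Set.mk_mem_prod hx' hy'))).not_ge
    (hk.le_of_le ha hb hab hp.le hq.le hpx'.le hqy'.le)

theorem logConcave [NormedSpace ℝ E] [l.NeBot] (h : HypoTendsto l F f)
    (hF : ∀ᶠ k in l, LogConcave (F k)) : LogConcave f where
  nonneg x := h.le_apply (hF.mono fun _ hk => hk.nonneg x)
  rpow_mul_rpow_le x y a b ha hb hab := by
    have hnonneg (z : E) : 0 ≤ f z := h.le_apply (hF.mono fun _ hk => hk.nonneg z)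
    rcases (hnonneg x).eq_or_lt with hx | hx
    · rw [← hx, Real.zero_rpow ha.ne', zero_mul]
      exact hnonneg _
    rcases (hnonneg y).eq_or_lt with hy | hy
    · rw [← hy, Real.zero_rpow hb.ne', mul_zero]
      exact hnonneg _
    have hlim : Tendsto (fun z : ℝ × ℝ => z.1 ^ a * z.2 ^ b) (𝓝[<] f x ×ˢ 𝓝[<] f y)
        (𝓝 (f x ^ a * f y ^ b)) :=
      ((tendsto_fst.mono_right nhdsWithin_le_nhds).rpow_const (.inl hx.ne')).mul
        ((tendsto_snd.mono_right nhdsWithin_le_nhds).rpow_const (.inl hy.ne'))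
    refine le_of_tendsto hlim ?_
    filter_upwards [prod_mem_prod (Ioo_mem_nhdsLT hx) (Ioo_mem_nhdsLT hy)] with z hz
    exact h.rpow_mul_rpow_le_of_lt hF ha hb hab hz.1.1 hz.2.1 hz.1.2 hz.2.2

variable [InnerProductSpace ℝ E] [FiniteDimensional ℝ E]

/-- If `F k > c` at some point of each set of a ball-forcing family around `x`, then log-concavity
gives `F k x ≥ c`. -/
theorem tendsto_of_mem_interior [l.NeBot] (h : HypoTendsto l F f) (hF : ∀ᶠ k in l, LogConcave (F k))
    {x : E} (hx : x ∈ interior {x | 0 < f x}) : Tendsto (fun k => F k x) l (𝓝 (f x)) := by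
  refine tendsto_order.2 ⟨fun c' hc' => ?_, fun c hc => h.eventually_lt hc⟩
  have hf := h.logConcave hF
  obtain ⟨c, hc, hcx⟩ := exists_between (max_lt hc' (interior_subset (s := {x | 0 < f x}) hx))
  have hcont : ContinuousAt f x :=
    (hf.continuousOn hf.convex_support.interior isOpen_interior
      fun _ hy => interior_subset (s := {x | 0 < f x}) hy).continuousAt
        (isOpen_interior.mem_nhds hx)
  obtain ⟨s, hsU, ρ, hρ, hs⟩ := exists_isBallForcing_of_mem_nhds (hcont.eventually_const_lt hcx)
  have hmeet : ∀ᶠ k in l, ∀ A ∈ s, ∃ y ∈ A, c < F k y := by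
    rw [Filter.eventually_all_finset]
    intro A hA
    obtain ⟨y, hy⟩ := (hsU A hA).2
    exact h.lower y c ((hsU A hA).1 (mem_of_mem_nhds hy)) A hy
  filter_upwards [hF, hmeet] with k hFk hk
  have hball := hs {y | c ≤ F k y} (hFk.convex_superlevel ((le_max_right _ _).trans_lt hc))
    fun A hA => let ⟨y, hy, hlt⟩ := hk A hA; ⟨y, hlt.le, hy⟩
  exact (le_max_left _ _).trans_lt (hc.trans_le (hball (mem_ball_self hρ)))

theorem ae_tendsto [MeasurableSpace E] [BorelSpace E] [l.NeBot] (h : HypoTendsto l F f)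
    (hF : ∀ᶠ k in l, LogConcave (F k)) (μ : Measure E) [μ.IsAddHaarMeasure] :
    ∀ᵐ x ∂μ, Tendsto (fun k => F k x) l (𝓝 (f x)) := by
  have hf := h.logConcave hF
  filter_upwards [compl_mem_ae_iff.2 (hf.convex_support.addHaar_frontier μ)] with x hx
  by_cases hpos : 0 < f x
  · refine h.tendsto_of_mem_interior hF (by_contra fun hint => hx ⟨subset_closure hpos, hint⟩)
  · have hzero : f x = 0 := le_antisymm (not_lt.1 hpos) (hf.nonneg x)
    rw [hzero]
    exact tendsto_order.2 ⟨fun c hc => hF.mono fun k hk => hc.trans_le (hk.nonneg x),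
      fun c hc => h.eventually_lt (hzero ▸ hc)⟩

end HypoTendsto

end HypoTendstoLogConcave

section WeakConvergence

theorem lintegral_eq_setLIntegral_measure_ofReal_lt {Ω : Type*} [MeasurableSpace Ω] (μ : Measure Ω)
    [SFinite μ] {g : Ω → ENNReal} (hg : Measurable g) :
    ∫⁻ x, g x ∂μ = ∫⁻ t in Set.Ioi (0 : ℝ), μ {x | ENNReal.ofReal t < g x} := by
  have hvolume (c : ENNReal) : volume ({t : ℝ | ENNReal.ofReal t < c} ∩ Set.Ioi 0) = c := by
    rcases eq_or_ne c ⊤ with rfl | hc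
    · simp
    have hIoo : {t : ℝ | ENNReal.ofReal t < c} ∩ Set.Ioi 0 = Set.Ioo 0 c.toReal := by
      ext t
      exact and_comm.trans (and_congr_right fun ht => ENNReal.ofReal_lt_iff_lt_toReal ht.le hc)
    rw [hIoo, Real.volume_Ioo, sub_zero, ENNReal.ofReal_toReal hc]
  have hmeas : MeasurableSet {p : Ω × ℝ | ENNReal.ofReal p.2 < g p.1} :=
    measurableSet_lt measurable_snd.ennreal_ofReal (hg.comp measurable_fst)
  calc ∫⁻ x, g x ∂μ
      = ∫⁻ x, (volume.restrict (Set.Ioi (0 : ℝ))) {t | ENNReal.ofReal t < g x} ∂μ :=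
        lintegral_congr fun x => by
          rw [Measure.restrict_apply (measurableSet_lt ENNReal.measurable_ofReal measurable_const),
            hvolume]
    _ = μ.prod (volume.restrict (Set.Ioi 0)) {p | ENNReal.ofReal p.2 < g p.1} :=
        (Measure.prod_apply hmeas).symm
    _ = ∫⁻ t in Set.Ioi (0 : ℝ), μ {x | ENNReal.ofReal t < g x} := Measure.prod_apply_symm hmeas

variable {Ω : Type*} [MeasurableSpace Ω] [TopologicalSpace Ω] [OpensMeasurableSpace Ω]
  [HasOuterApproxClosed Ω] {Q : ℕ → ProbabilityMeasure Ω} {P : ProbabilityMeasure Ω}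

theorem measure_le_liminf_of_eventually_nhds_subset (hQ : Tendsto Q atTop (𝓝 P)) {A : Set Ω}
    {B : ℕ → Set Ω} (h : ∀ x ∈ A, ∃ U ∈ 𝓝 x, ∀ᶠ k in atTop, U ⊆ B k) :
    (P : Measure Ω) A ≤ liminf (fun k => (Q k : Measure Ω) (B k)) atTop := by
  let V (m : ℕ) : Set Ω := interior (⋂ k ≥ m, B k)
  have hVmono : Monotone V := fun m m' hmm' =>
    interior_mono (Set.biInter_subset_biInter_left fun k hk => hmm'.trans hk)
  have hAV : A ⊆ ⋃ m, V m := fun x hx => by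
    obtain ⟨U, hU, hUB⟩ := h x hx
    obtain ⟨m, hm⟩ := eventually_atTop.1 hUB
    exact Set.mem_iUnion.2 ⟨m, mem_interior_iff_mem_nhds.2
      (mem_of_superset hU (Set.subset_iInter₂ hm))⟩
  calc (P : Measure Ω) A ≤ (P : Measure Ω) (⋃ m, V m) := measure_mono hAV
    _ = ⨆ m, (P : Measure Ω) (V m) := hVmono.measure_iUnion
    _ ≤ liminf (fun k => (Q k : Measure Ω) (B k)) atTop := iSup_le fun m => ?_
  refine (ProbabilityMeasure.le_liminf_measure_open_of_tendsto hQ isOpen_interior).trans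
    (liminf_le_liminf ?_)
  filter_upwards [eventually_ge_atTop m] with k hk
  exact measure_mono (interior_subset.trans (Set.biInter_subset_of_mem hk))

/-- Integrate `measure_le_liminf_of_eventually_nhds_subset` over the superlevel sets and apply
Fatou's lemma. -/
theorem lintegral_le_liminf_of_tendsto (hQ : Tendsto Q atTop (𝓝 P)) {G : ℕ → Ω → ENNReal}
    {g : Ω → ENNReal} (hG : ∀ k, Measurable (G k)) (hg : Measurable g)
    (h : ∀ x, ∀ c < g x, ∃ U ∈ 𝓝 x, ∀ᶠ k in atTop, ∀ y ∈ U, c < G k y) :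
    ∫⁻ x, g x ∂(P : Measure Ω) ≤ liminf (fun k => ∫⁻ x, G k x ∂(Q k : Measure Ω)) atTop := by
  simp only [lintegral_eq_setLIntegral_measure_ofReal_lt _ hg,
    lintegral_eq_setLIntegral_measure_ofReal_lt _ (hG _)]
  refine (lintegral_mono fun t => measure_le_liminf_of_eventually_nhds_subset hQ
    fun x hx => h x _ hx).trans (lintegral_liminf_le fun k => Antitone.measurable fun t t' htt' =>
      measure_mono fun x hx => (ENNReal.ofReal_le_ofReal htt').trans_lt hx)

end WeakConvergence

section Compactness

theorem exists_forall_ofReal_le_measure_of_tendsto {ι Ω : Type*} [MeasurableSpace Ω]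
    [TopologicalSpace Ω] [OpensMeasurableSpace Ω] [HasOuterApproxClosed Ω] {l : Filter ι}
    {Q : ι → ProbabilityMeasure Ω} {P : ProbabilityMeasure Ω} (hQ : Tendsto Q l (𝓝 P))
    {s : Finset (Set Ω)} (hs : ∀ A ∈ s, IsOpen A ∧ 0 < (P : Measure Ω) A) :
    ∃ η : ℝ, 0 < η ∧ η < 1 ∧ ∀ᶠ k in l, ∀ A ∈ s, ENNReal.ofReal η ≤ (Q k : Measure Ω) A := by
  have hsmall : ∀ᶠ η in 𝓝[>] (0 : ℝ), ∀ A ∈ s, ENNReal.ofReal η < (P : Measure Ω) A := by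
    rw [Filter.eventually_all_finset]
    intro A hA
    have hlim : Tendsto ENNReal.ofReal (𝓝[>] 0) (𝓝 0) := by
      simpa using (ENNReal.continuous_ofReal.tendsto 0).mono_left nhdsWithin_le_nhds
    exact hlim.eventually_lt_const (hs A hA).2
  obtain ⟨η, hηs, hη0, hη1⟩ := (hsmall.and (Ioo_mem_nhdsGT zero_lt_one)).exists
  refine ⟨η, hη0, hη1, (Filter.eventually_all_finset s).2 fun A hA => ?_⟩
  have hliminf := (hηs A hA).trans_le
    (ProbabilityMeasure.le_liminf_measure_open_of_tendsto hQ (hs A hA).1)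
  exact (eventually_lt_of_lt_liminf hliminf).mono fun _ hk => hk.le

variable {d : ℕ} {f : Eucl d → ℝ}

theorem IsLogConcaveDensity.of_hypoTendsto {ι : Type*} {l : Filter ι} [l.NeBot]
    [l.IsCountablyGenerated] {F : ι → Eucl d → ℝ} (hF : ∀ᶠ k in l, IsLogConcaveDensity (F k))
    {a b : ℝ} (hb : 0 < b) (hFab : ∀ᶠ k in l, ∀ x, F k x ≤ Real.exp (a - b * ‖x‖))
    (h : HypoTendsto l F f) : IsLogConcaveDensity f := by
  have hFlc : ∀ᶠ k in l, LogConcave (F k) := hF.mono fun _ hk => hk.logConcave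
  refine .of_logConcave (h.logConcave hFlc) h.upperSemicontinuous (tendsto_nhds_unique
    (tendsto_lintegral_filter_of_dominated_convergence
      (fun x => ENNReal.ofReal (Real.exp (a - b * ‖x‖)))
      (hF.mono fun k hk => hk.measurable.ennreal_ofReal) ?_
      (lintegral_exp_sub_norm_lt_top volume a hb).ne ?_) ?_)
  · exact hFab.mono fun k hk => Eventually.of_forall fun x => ENNReal.ofReal_le_ofReal (hk x)
  · exact (h.ae_tendsto hFlc volume).mono fun x hx =>
      (ENNReal.continuous_ofReal.tendsto _).comp hx
  · exact tendsto_const_nhds.congr' (hF.mono fun k hk => hk.lintegral_eq_one.symm)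

variable {Q : ℕ → ProbabilityMeasure (Eucl d)} {P : ProbabilityMeasure (Eucl d)}
  {F : ℕ → Eucl d → ℝ}

theorem HypoTendsto.liminf_extIntegral_logFun_le (h : HypoTendsto atTop F f)
    (hQ : Tendsto Q atTop (𝓝 P)) (hF : ∀ k, Measurable (F k)) {M : ℝ}
    (hM : ∀ k x, F k x ≤ Real.exp M) :
    liminf (fun k => extIntegral (logFun (F k)) (Q k)) atTop ≤ extIntegral (logFun f) P := by
  have hf : Measurable f := h.upperSemicontinuous.measurable
  have hfM (x : Eucl d) : f x ≤ Real.exp M :=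
    h.apply_le (Eventually.of_forall fun k => hM k)
  refine EReal.ge_of_forall_gt_iff_ge.1 fun c hc => ?_
  have hc' : ∀ᶠ k in atTop, c ≤ M ∧
      ∫⁻ x, logDeficit M (F k x) ∂(Q k : Measure (Eucl d)) ≤ ENNReal.ofReal (M - c) :=
    (eventually_lt_of_lt_liminf hc).mono fun k hk =>
      (coe_le_extIntegral_logFun_iff _ (hF k) (hM k)).1 hk.le
  refine (coe_le_extIntegral_logFun_iff _ hf hfM).2 ⟨hc'.exists.choose_spec.1, ?_⟩
  refine (lintegral_le_liminf_of_tendsto hQ (fun k => (measurable_logDeficit M).comp (hF k))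
    ((measurable_logDeficit M).comp hf) fun x e he => ?_).trans
    (liminf_le_of_frequently_le' (hc'.mono fun k hk => hk.2).frequently)
  obtain ⟨U, hU, hlt⟩ := h.upper x _ ((lt_logDeficit_iff he.ne_top).1 he)
  exact ⟨U, hU, hlt.mono fun k hk y hy => (lt_logDeficit_iff he.ne_top).2 (hk y hy)⟩

theorem eventually_hasExpBounds (hP : InClassP (P : Measure (Eucl d)))
    (hQ : Tendsto Q atTop (𝓝 P)) (hF : ∀ᶠ k in atTop, IsLogConcaveDensity (F k))
    (hlik : liminf (fun k => extIntegral (logFun (F k)) (Q k)) atTop ≠ ⊥) :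
    ∃ (x₀ : Eucl d) (ρ t M : ℝ), 0 < ρ ∧ ∀ᶠ k in atTop, HasExpBounds x₀ ρ t M (F k) := by
  obtain ⟨s, x₀, ρ, hρ, hs, hball⟩ := hP.exists_isBallForcing
  obtain ⟨η, hη0, hη1, hη⟩ := exists_forall_ofReal_le_measure_of_tendsto hQ hs
  obtain ⟨c, -, hc⟩ := EReal.lt_iff_exists_real_btwn.1 (bot_lt_iff_ne_bot.2 hlik)
  obtain ⟨t, M, hbounds⟩ := exists_hasExpBounds_of_le_extIntegral hball hρ hη0 hη1 c
  refine ⟨x₀, ρ, t, M, hρ, ?_⟩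
  filter_upwards [hF, hη, eventually_lt_of_lt_liminf hc] with k hFk hηk hck
  exact hbounds (Q k) inferInstance hηk (F k) hFk hck.le

/-- Densities with log-likelihoods bounded below along a weakly convergent sequence of measures are
relatively compact, and the log-likelihood is upper semicontinuous. -/
theorem exists_subseq_isLogConcaveDensity (hP : InClassP (P : Measure (Eucl d)))
    (hQ : Tendsto Q atTop (𝓝 P)) (hF : ∀ᶠ k in atTop, IsLogConcaveDensity (F k))
    (hlik : liminf (fun k => extIntegral (logFun (F k)) (Q k)) atTop ≠ ⊥) :
    ∃ φ : ℕ → ℕ, StrictMono φ ∧ ∃ f, IsLogConcaveDensity f ∧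
      HypoTendsto atTop (fun k => F (φ k)) f ∧
      liminf (fun k => extIntegral (logFun (F k)) (Q k)) atTop ≤ extIntegral (logFun f) P := by
  obtain ⟨x₀, ρ, t, M, hρ, hbounds⟩ := eventually_hasExpBounds hP hQ hF hlik
  obtain ⟨φ, hφ, hFφ⟩ := extraction_of_eventually_atTop (hF.and hbounds)
  obtain ⟨ψ, hψ, f, hlim⟩ := exists_subseq_hypoTendsto_of_mem_Icc
    (F := fun k => F (φ k)) fun k x => ⟨(hFφ k).1.nonneg x, (hFφ k).2.le_exp x⟩
  obtain ⟨a, b, hb, hab⟩ := LogConcave.exists_forall_le_exp_sub_norm volume x₀ hρ t M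
  refine ⟨φ ∘ ψ, hφ.comp hψ, f, .of_hypoTendsto
    (Eventually.of_forall fun k => (hFφ (ψ k)).1) hb (Eventually.of_forall fun k =>
      hab _ (hFφ _).1.logConcave (hFφ _).1.measurable (hFφ _).1.lintegral_eq_one.le (hFφ _).2) hlim,
    hlim, ?_⟩
  have htop : Tendsto (φ ∘ ψ) atTop atTop := (hφ.comp hψ).tendsto_atTop
  calc liminf (fun k => extIntegral (logFun (F k)) (Q k)) atTop
      ≤ liminf (fun k => extIntegral (logFun (F k)) (Q k)) (map (φ ∘ ψ) atTop) :=
        liminf_le_liminf_of_le htop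
    _ ≤ extIntegral (logFun f) P := hlim.liminf_extIntegral_logFun_le (hQ.comp htop)
        (fun k => (hFφ _).1.measurable) fun k => (hFφ _).2.le_exp

end Compactness

section Existence

theorem logConcave_exp_of_concaveOn {E : Type*} [AddCommGroup E] [Module ℝ E] {φ : E → ℝ}
    (hφ : ConcaveOn ℝ Set.univ φ) : LogConcave fun x => Real.exp (φ x) where
  nonneg x := (Real.exp_pos _).le
  rpow_mul_rpow_le x y a b ha hb hab := by
    rw [← Real.exp_mul, ← Real.exp_mul, ← Real.exp_add, Real.exp_le_exp, mul_comm, mul_comm (φ y)]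
    exact hφ.2 (Set.mem_univ x) (Set.mem_univ y) ha.le hb.le hab

variable {d : ℕ}

theorem IsLogConcaveDensity.of_logConcave_div {f : Eucl d → ℝ} (hf : LogConcave f)
    (husc : UpperSemicontinuous f) (h0 : ∫⁻ x, ENNReal.ofReal (f x) ≠ 0)
    (htop : ∫⁻ x, ENNReal.ofReal (f x) ≠ ⊤) :
    IsLogConcaveDensity fun x => f x / (∫⁻ x, ENNReal.ofReal (f x)).toReal := by
  set c := (∫⁻ x, ENNReal.ofReal (f x)).toReal with hc
  have hcpos : 0 < c := ENNReal.toReal_pos h0 htop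
  refine .of_logConcave (hf.div_const hcpos) ?_ ?_
  · exact (continuous_id.div_const c).comp_upperSemicontinuous husc
      fun s t hst => div_le_div_of_nonneg_right hst hcpos.le
  · simp only [ENNReal.ofReal_div_of_pos hcpos]
    simp only [hc, ENNReal.ofReal_toReal htop, div_eq_mul_inv]
    rw [lintegral_mul_const' _ _ (ENNReal.inv_ne_top.2 h0), ENNReal.mul_inv_cancel h0 htop]

theorem exists_isLogConcaveDensity_exp_sub_norm (d : ℕ) :
    ∃ M, IsLogConcaveDensity fun x : Eucl d => Real.exp (M - ‖x‖) := by
  set K := ∫⁻ x : Eucl d, ENNReal.ofReal (Real.exp (-‖x‖))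
  have htop : K ≠ ⊤ := by
    simpa using (lintegral_exp_sub_norm_lt_top (volume : Measure (Eucl d)) 0 one_pos).ne
  have h0 : K ≠ 0 := by
    rw [← pos_iff_ne_zero, lintegral_pos_iff_support (by fun_prop)]
    simpa [Function.support, Real.exp_pos] using NeZero.ne (volume : Measure (Eucl d))
  refine ⟨-Real.log K.toReal, ?_⟩
  have hconc : LogConcave fun x : Eucl d => Real.exp (-‖x‖) :=
    logConcave_exp_of_concaveOn convexOn_univ_norm.neg
  convert! IsLogConcaveDensity.of_logConcave_div hconc
    (Continuous.upperSemicontinuous (by fun_prop)) h0 htop using 2 with x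
  rw [sub_eq_add_neg, neg_add_eq_sub, Real.exp_sub, Real.exp_log (ENNReal.toReal_pos h0 htop)]

theorem InClassP.exists_isLogConcaveDensity {P : Measure (Eucl d)} (hP : InClassP P) :
    ∃ g, IsLogConcaveDensity g ∧ extIntegral (logFun g) P ≠ ⊥ := by
  have := hP.isProbabilityMeasure
  obtain ⟨M, hg⟩ := exists_isLogConcaveDensity_exp_sub_norm d
  refine ⟨_, hg, ?_⟩
  rw [extIntegral_logFun_eq P hg.measurable (M := M) fun x => by simp]
  simp only [logDeficit_exp, sub_sub_cancel]
  rw [← EReal.coe_ennreal_toReal hP.finite_mean.ne, ← EReal.coe_sub]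
  exact EReal.coe_ne_bot _

theorem IsMaximiser.extIntegral_ne_bot {f : Eucl d → ℝ} (hf : IsMaximiser P f) (hP : InClassP P) :
    extIntegral (logFun f) P ≠ ⊥ :=
  let ⟨g, hg, hgbot⟩ := hP.exists_isLogConcaveDensity
  ne_bot_of_le_ne_bot hgbot (hf.2 g hg)

theorem InClassP.exists_isMaximiser {P : Measure (Eucl d)} (hP : InClassP P) :
    ∃ f, IsMaximiser P f := by
  have hprob := hP.isProbabilityMeasure
  obtain ⟨g, hg, hgbot⟩ := hP.exists_isLogConcaveDensity
  set S : Set EReal := (fun h => extIntegral (logFun h) P) '' {h | IsLogConcaveDensity h}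
  have hgS : extIntegral (logFun g) P ∈ S := ⟨g, hg, rfl⟩
  obtain ⟨u, -, hu, huS⟩ := exists_seq_tendsto_sSup ⟨_, hgS⟩ (OrderTop.bddAbove S)
  choose F hF hFu using huS
  have hlim : Tendsto (fun k => extIntegral (logFun (F k)) P) atTop (𝓝 (sSup S)) :=
    hu.congr fun k => (hFu k).symm
  obtain ⟨-, -, f, hf, -, hmax⟩ := exists_subseq_isLogConcaveDensity (P := ⟨P, hprob⟩) hP
    (Q := fun _ => ⟨P, hprob⟩) tendsto_const_nhds (Eventually.of_forall hF)
    (hlim.liminf_eq.trans_ne (ne_bot_of_le_ne_bot hgbot (le_sSup hgS)))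
  exact ⟨f, hf, fun h hh =>
    (le_sSup (Set.mem_image_of_mem _ hh)).trans (hlim.liminf_eq.symm.trans_le hmax)⟩

end Existence

section AeEq

variable {E : Type*} [NormedAddCommGroup E] [NormedSpace ℝ E] {f g : E → ℝ}

theorem LogConcave.mem_closure_interior_superlevel (hf : LogConcave f) {x₀ x : E} {ρ t m : ℝ}
    (hρ : 0 < ρ) (hball : ∀ y ∈ ball x₀ ρ, Real.exp t ≤ f y) (hm : Real.exp m < f x) :
    x ∈ closure (interior {y | Real.exp m ≤ f y}) := by
  have hlogm : m < Real.log (f x) := (Real.lt_log_iff_exp_lt ((Real.exp_pos m).trans hm)).2 hm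
  have hcenter : Tendsto (fun l : ℝ => (1 - l) • x + l • x₀) (𝓝[>] 0) (𝓝 x) := by
    have : Continuous fun l : ℝ => (1 - l) • x + l • x₀ := by fun_prop
    simpa using (this.tendsto 0).mono_left nhdsWithin_le_nhds
  have hlevel : Tendsto (fun l : ℝ => (1 - l) * Real.log (f x) + l * t) (𝓝[>] 0)
      (𝓝 (Real.log (f x))) := by
    have : Continuous fun l : ℝ => (1 - l) * Real.log (f x) + l * t := by fun_prop
    simpa using (this.tendsto 0).mono_left nhdsWithin_le_nhds
  refine mem_closure_of_tendsto hcenter ?_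
  filter_upwards [hlevel.eventually_const_lt hlogm, Ioo_mem_nhdsGT zero_lt_one]
    with l hl ⟨hl0, hl1⟩
  refine mem_interior.2 ⟨ball _ (l * ρ), fun y hy => ?_, isOpen_ball,
    mem_ball_self (mul_pos hl0 hρ)⟩
  exact (Real.exp_le_exp.2 hl.le).trans (hf.exp_le_on_ball hball
    (Real.exp_log ((Real.exp_pos m).trans hm)).le hl0 hl1 y hy)

theorem LogConcave.le_of_ae_eq [MeasurableSpace E] {μ : Measure E} [μ.IsOpenPosMeasure]
    (hf : LogConcave f) {x₀ : E} {ρ t : ℝ} (hρ : 0 < ρ)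
    (hball : ∀ y ∈ ball x₀ ρ, Real.exp t ≤ f y) (hg : UpperSemicontinuous g) (hg0 : ∀ x, 0 ≤ g x)
    (hfg : f =ᵐ[μ] g) (x : E) : f x ≤ g x := by
  by_contra! hlt
  obtain ⟨c, hgc, hcf⟩ := exists_between hlt
  obtain ⟨m, rfl⟩ : ∃ m, c = Real.exp m := ⟨_, (Real.exp_log ((hg0 x).trans_lt hgc)).symm⟩
  obtain ⟨U, hUg, hU, hxU⟩ := _root_.mem_nhds_iff.1 (hg x _ hgc)
  have hne : (U ∩ interior {y | Real.exp m ≤ f y}).Nonempty :=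
    mem_closure_iff.1 (hf.mem_closure_interior_superlevel hρ hball hcf) U hU hxU
  obtain ⟨y, hy, ⟨hyU, hyf⟩⟩ := (Measure.dense_of_ae hfg).inter_open_nonempty _
    (hU.inter isOpen_interior) hne |>.imp fun y hy => And.symm hy
  exact (hUg hyU).not_ge ((interior_subset hyf).trans_eq hy)

theorem IsLogConcaveDensity.eq_of_ae_eq {d : ℕ} {f g : Eucl d → ℝ} (hf : IsLogConcaveDensity f)
    (hg : IsLogConcaveDensity g) (hfg : f =ᵐ[volume] g) : f = g := by
  obtain ⟨_, _, hρf, _, _, hfb⟩ := hf.exists_hasExpBounds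
  obtain ⟨_, _, hρg, _, _, hgb⟩ := hg.exists_hasExpBounds
  exact funext fun x => le_antisymm
    (hf.logConcave.le_of_ae_eq hρf hfb.exp_le hg.usc hg.nonneg hfg x)
    (hg.logConcave.le_of_ae_eq hρg hgb.exp_le hf.usc hf.nonneg hfg.symm x)

end AeEq

section GeometricMean

theorem upperSemicontinuous_sqrt_mul {X : Type*} [TopologicalSpace X] {f g : X → ℝ}
    (hf : UpperSemicontinuous f) (hg : UpperSemicontinuous g) (hf0 : ∀ x, 0 ≤ f x)
    (hg0 : ∀ x, 0 ≤ g x) : UpperSemicontinuous fun x => √(f x * g x) := by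
  intro x r hr
  have hlim : Tendsto (fun δ : ℝ => √((f x + δ) * (g x + δ))) (𝓝[>] 0) (𝓝 √(f x * g x)) := by
    have : Continuous fun δ : ℝ => √((f x + δ) * (g x + δ)) := by fun_prop
    simpa using (this.tendsto 0).mono_left nhdsWithin_le_nhds
  obtain ⟨δ, hδr, hδ⟩ := ((hlim.eventually_lt_const hr).and self_mem_nhdsWithin).exists
  filter_upwards [hf x _ (lt_add_of_pos_right (f x) hδ), hg x _ (lt_add_of_pos_right (g x) hδ)]
    with y hfy hgy
  exact (Real.sqrt_le_sqrt (mul_le_mul hfy.le hgy.le (hg0 y) ((hf0 y).trans hfy.le))).trans_lt hδr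

theorem sqrt_mul_le_half_add {a b : ℝ} (ha : 0 ≤ a) (hb : 0 ≤ b) : √(a * b) ≤ (a + b) / 2 :=
  Real.sqrt_le_iff.2 ⟨by positivity, by linarith [sq_nonneg (a - b)]⟩

theorem sqrt_mul_eq_half_add_iff {a b : ℝ} (ha : 0 ≤ a) (hb : 0 ≤ b) :
    √(a * b) = (a + b) / 2 ↔ a = b := by
  rw [Real.sqrt_eq_iff_mul_self_eq (mul_nonneg ha hb) (by positivity), ← sub_eq_zero,
    ← sub_eq_zero (a := a), ← sq_eq_zero_iff (a := a - b)]
  constructor <;> intro h <;> linarith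

theorem ae_eq_of_lintegral_half_add_le_lintegral_sqrt_mul {α : Type*} [MeasurableSpace α]
    {μ : Measure α} {f g : α → ℝ} (hf : Measurable f) (hg : Measurable g) (hf0 : ∀ x, 0 ≤ f x)
    (hg0 : ∀ x, 0 ≤ g x) (htop : ∫⁻ x, ENNReal.ofReal ((f x + g x) / 2) ∂μ ≠ ⊤)
    (hle : ∫⁻ x, ENNReal.ofReal ((f x + g x) / 2) ∂μ ≤ ∫⁻ x, ENNReal.ofReal √(f x * g x) ∂μ) :
    f =ᵐ[μ] g := by
  have hpt (x : α) : ENNReal.ofReal √(f x * g x) ≤ ENNReal.ofReal ((f x + g x) / 2) :=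
    ENNReal.ofReal_le_ofReal (sqrt_mul_le_half_add (hf0 x) (hg0 x))
  filter_upwards [ae_eq_of_ae_le_of_lintegral_le (ae_of_all _ hpt)
    (ne_top_of_le_ne_top htop (lintegral_mono hpt)) (by fun_prop) hle] with x hx
  rwa [ENNReal.ofReal_eq_ofReal_iff (Real.sqrt_nonneg _)
    (div_nonneg (add_nonneg (hf0 x) (hg0 x)) zero_le_two),
    sqrt_mul_eq_half_add_iff (hf0 x) (hg0 x)] at hx

theorem logDeficit_sqrt_mul {M s t : ℝ} (hs : 0 ≤ s) (hsM : s ≤ Real.exp M) (ht : 0 ≤ t)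
    (htM : t ≤ Real.exp M) :
    logDeficit M √(s * t) = (logDeficit M s + logDeficit M t) / 2 := by
  rcases hs.eq_or_lt with rfl | hs
  · simp [logDeficit_of_nonpos le_rfl, ENNReal.top_div]
  rcases ht.eq_or_lt with rfl | ht
  · simp [logDeficit_of_nonpos le_rfl, ENNReal.top_div]
  rw [logDeficit_of_pos hs, logDeficit_of_pos ht, logDeficit_of_pos (by positivity),
    ← ENNReal.ofReal_add (sub_nonneg.2 ((Real.log_le_iff_le_exp hs).2 hsM))
      (sub_nonneg.2 ((Real.log_le_iff_le_exp ht).2 htM)),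
    ← ENNReal.ofReal_ofNat, ← ENNReal.ofReal_div_of_pos two_pos,
    Real.log_sqrt (mul_pos hs ht).le, Real.log_mul hs.ne' ht.ne']
  congr 1
  ring

theorem logDeficit_div {M t c : ℝ} (hc : 0 < c) :
    logDeficit (M - Real.log c) (t / c) = logDeficit M t := by
  rcases le_or_gt t 0 with ht | ht
  · rw [logDeficit_of_nonpos ht, logDeficit_of_nonpos (div_nonpos_of_nonpos_of_nonneg ht hc.le)]
  · rw [logDeficit_of_pos ht, logDeficit_of_pos (div_pos ht hc), Real.log_div ht.ne' hc.ne',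
      sub_sub_sub_cancel_right]

end GeometricMean

section Uniqueness

variable {d : ℕ} {P : Measure (Eucl d)} {f g : Eucl d → ℝ} {M v : ℝ}

section Likelihood

variable [IsProbabilityMeasure P]

theorem extIntegral_logFun_ne_top (hf : Measurable f) (hM : ∀ x, f x ≤ Real.exp M) :
    extIntegral (logFun f) P ≠ ⊤ := by
  rw [extIntegral_logFun_eq P hf hM]
  exact EReal.add_ne_top (EReal.coe_ne_top M) (by simp)

theorem ae_pos_of_coe_le_extIntegral_logFun (hf : Measurable f) (hM : ∀ x, f x ≤ Real.exp M)
    (hv : (v : EReal) ≤ extIntegral (logFun f) P) : ∀ᵐ x ∂P, 0 < f x := by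
  have hfin := ne_top_of_le_ne_top ENNReal.ofReal_ne_top
    ((coe_le_extIntegral_logFun_iff P hf hM).1 hv).2
  filter_upwards [ae_lt_top ((measurable_logDeficit M).comp hf) hfin] with x hx
  exact not_le.1 fun h => hx.ne (logDeficit_of_nonpos h)

theorem coe_le_extIntegral_logFun_sqrt_mul (hf : Measurable f) (hf0 : ∀ x, 0 ≤ f x)
    (hfM : ∀ x, f x ≤ Real.exp M) (hg : Measurable g) (hg0 : ∀ x, 0 ≤ g x)
    (hgM : ∀ x, g x ≤ Real.exp M) (hfv : (v : EReal) ≤ extIntegral (logFun f) P)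
    (hgv : (v : EReal) ≤ extIntegral (logFun g) P) :
    (v : EReal) ≤ extIntegral (logFun fun x => √(f x * g x)) P := by
  obtain ⟨hvM, hf'⟩ := (coe_le_extIntegral_logFun_iff P hf hfM).1 hfv
  have hg' := ((coe_le_extIntegral_logFun_iff P hg hgM).1 hgv).2
  refine (coe_le_extIntegral_logFun_iff P (hf.mul hg).sqrt fun x => ?_).2 ⟨hvM, ?_⟩
  · exact Real.sqrt_le_iff.2 ⟨(Real.exp_pos M).le,
      (mul_le_mul (hfM x) (hgM x) (hg0 x) (Real.exp_pos M).le).trans_eq (sq _).symm⟩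
  · have hdeficit (x : Eucl d) : logDeficit M √(f x * g x) =
        (logDeficit M (f x) + logDeficit M (g x)) * 2⁻¹ :=
      logDeficit_sqrt_mul (hf0 x) (hfM x) (hg0 x) (hgM x)
    simp only [Pi.mul_apply]
    have hdeficitm : Measurable fun x => logDeficit M (f x) := (measurable_logDeficit M).comp hf
    rw [lintegral_congr hdeficit, lintegral_mul_const' _ _ (by simp),
      lintegral_add_left hdeficitm, ← div_eq_mul_inv]
    exact ENNReal.div_le_of_le_mul ((add_le_add hf' hg').trans_eq (mul_two _).symm)

theorem coe_le_extIntegral_logFun_div (hf : Measurable f) (hfM : ∀ x, f x ≤ Real.exp M)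
    (hfv : (v : EReal) ≤ extIntegral (logFun f) P) {c : ℝ} (hc : 0 < c) :
    ((v - Real.log c : ℝ) : EReal) ≤ extIntegral (logFun fun x => f x / c) P := by
  obtain ⟨hvM, hf'⟩ := (coe_le_extIntegral_logFun_iff P hf hfM).1 hfv
  refine (coe_le_extIntegral_logFun_iff P (M := M - Real.log c) (hf.div_const c)
    fun x => ?_).2 ⟨sub_le_sub_right hvM _, ?_⟩
  · rw [Real.exp_sub, Real.exp_log hc]
    exact div_le_div_of_nonneg_right (hfM x) hc.le
  · simpa only [logDeficit_div hc, sub_sub_sub_cancel_right] using hf'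

end Likelihood

theorem InClassP.lintegral_ofReal_sqrt_mul_ne_zero (hP : InClassP P) (hf : LogConcave f)
    (hg : LogConcave g) (hfm : Measurable f) (hgm : Measurable g) (hfpos : ∀ᵐ x ∂P, 0 < f x)
    (hgpos : ∀ᵐ x ∂P, 0 < g x) : ∫⁻ x, ENNReal.ofReal √(f x * g x) ≠ 0 := by
  obtain ⟨x₀, ρ, hρ, hsub⟩ := hP.exists_ball_subset (hf.convex_support.inter hg.convex_support)
    (ae_iff.1 (hfpos.and hgpos))
  refine ((lintegral_pos_iff_support (by fun_prop)).2
    ((measure_ball_pos volume x₀ hρ).trans_le (measure_mono fun x hx => ?_))).ne'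
  exact (ENNReal.ofReal_pos.2 (Real.sqrt_pos.2 (mul_pos (hsub hx).1 (hsub hx).2))).ne'

theorem IsLogConcaveDensity.lintegral_half_add (hf : IsLogConcaveDensity f)
    (hg : IsLogConcaveDensity g) : ∫⁻ x, ENNReal.ofReal ((f x + g x) / 2) = 1 := by
  simp only [ENNReal.ofReal_div_of_pos two_pos, ENNReal.ofReal_add (hf.nonneg _) (hg.nonneg _)]
  simp only [div_eq_mul_inv]
  rw [lintegral_mul_const' _ _ (by simp), lintegral_add_left hf.measurable.ennreal_ofReal,
    hf.lintegral_eq_one, hg.lintegral_eq_one, one_add_one_eq_two, ENNReal.ofReal_ofNat,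
    ENNReal.mul_inv_cancel two_ne_zero ENNReal.ofNat_ne_top]

/-- The likelihood of `√(fg)` is at least the maximum, and dividing by a normalising constant
below `1` would increase it further. -/
theorem IsMaximiser.one_le_lintegral_sqrt_mul (hf : IsMaximiser P f) (hP : InClassP P)
    (hg : IsMaximiser P g) : 1 ≤ ∫⁻ x, ENNReal.ofReal √(f x * g x) := by
  have := hP.isProbabilityMeasure
  obtain ⟨_, _, _, _, Mf, hfb⟩ := hf.1.exists_hasExpBounds
  obtain ⟨_, _, _, _, Mg, hgb⟩ := hg.1.exists_hasExpBounds
  obtain ⟨M, hfM, hgM⟩ : ∃ M, (∀ x, f x ≤ Real.exp M) ∧ ∀ x, g x ≤ Real.exp M :=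
    ⟨max Mf Mg, fun x => (hfb.le_exp x).trans (Real.exp_le_exp.2 (le_max_left _ _)),
      fun x => (hgb.le_exp x).trans (Real.exp_le_exp.2 (le_max_right _ _))⟩
  obtain ⟨v, hv⟩ : ∃ v : ℝ, (v : EReal) = extIntegral (logFun f) P :=
    ⟨_, EReal.coe_toReal (extIntegral_logFun_ne_top hf.1.measurable hfM) (hf.extIntegral_ne_bot hP)⟩
  have hvg : (v : EReal) ≤ extIntegral (logFun g) P := hv.trans_le (hg.2 f hf.1)
  have h0 := hP.lintegral_ofReal_sqrt_mul_ne_zero hf.1.logConcave hg.1.logConcave hf.1.measurable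
    hg.1.measurable (ae_pos_of_coe_le_extIntegral_logFun hf.1.measurable hfM hv.le)
    (ae_pos_of_coe_le_extIntegral_logFun hg.1.measurable hgM hvg)
  have hmean (x : Eucl d) : (f x + g x) / 2 ≤ Real.exp M := by linarith [hfM x, hgM x]
  by_contra! hlt
  have hc : 0 < (∫⁻ x, ENNReal.ofReal √(f x * g x)).toReal := ENNReal.toReal_pos h0 hlt.ne_top
  have hlik := coe_le_extIntegral_logFun_div (hf.1.measurable.mul hg.1.measurable).sqrt
    (fun x => (sqrt_mul_le_half_add (hf.1.nonneg x) (hg.1.nonneg x)).trans (hmean x))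
    (coe_le_extIntegral_logFun_sqrt_mul hf.1.measurable hf.1.nonneg hfM hg.1.measurable
      hg.1.nonneg hgM hv.le hvg) hc
  have hle := hlik.trans (hf.2 _ (.of_logConcave_div (hf.1.logConcave.sqrt_mul hg.1.logConcave)
    (upperSemicontinuous_sqrt_mul hf.1.usc hg.1.usc hf.1.nonneg hg.1.nonneg) h0 hlt.ne_top))
  rw [← hv, EReal.coe_le_coe_iff, sub_le_self_iff, Real.log_nonneg_iff hc] at hle
  exact hlt.not_ge ((ENNReal.ofReal_one.symm.trans_le (ENNReal.ofReal_le_ofReal hle)).trans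
    ENNReal.ofReal_toReal_le)

theorem IsMaximiser.unique (hf : IsMaximiser P f) (hP : InClassP P) (hg : IsMaximiser P g) :
    f = g := by
  have hmean := hf.1.lintegral_half_add hg.1
  exact hf.1.eq_of_ae_eq hg.1 (ae_eq_of_lintegral_half_add_le_lintegral_sqrt_mul hf.1.measurable
    hg.1.measurable hf.1.nonneg hg.1.nonneg (hmean.trans_ne ENNReal.one_ne_top)
    (hmean.trans_le (hf.one_le_lintegral_sqrt_mul hP hg)))

theorem InClassP.projWellDefined (hP : InClassP P) : ProjWellDefined P :=
  let ⟨f, hf⟩ := hP.exists_isMaximiser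
  ⟨hP, f, hf, fun _ hg => hg.unique hP hf⟩

theorem InClassP.isMaximiser_logConcaveProj (hP : InClassP P) :
    IsMaximiser P (logConcaveProj P) := by
  rw [logConcaveProj, dif_pos hP.exists_isMaximiser]
  exact hP.exists_isMaximiser.choose_spec

end Uniqueness

section Stability

/-- On a large sphere the limit lies strictly below the required envelope, hence so does `F k`
eventually, and log-concavity propagates this bound outwards. -/
theorem HypoTendsto.eventually_le_exp_sub_norm {ι E : Type*} [NormedAddCommGroup E]
    [NormedSpace ℝ E] [FiniteDimensional ℝ E] {l : Filter ι} {F : ι → E → ℝ} {f : E → ℝ}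
    (h : HypoTendsto l F f) (hF : ∀ᶠ k in l, LogConcave (F k)) {x₀ : E} {ρ t M : ℝ} (hρ : 0 < ρ)
    (hbounds : ∀ᶠ k in l, HasExpBounds x₀ ρ t M (F k)) {α₀ β₀ α : ℝ} (hα : 0 < α) (hαα₀ : α < α₀)
    (hf : ∀ x, f x ≤ Real.exp (-α₀ * ‖x‖ + β₀)) :
    ∃ a, ∀ᶠ k in l, ∀ x, F k x ≤ Real.exp (a - α * ‖x‖) := by
  have := FiniteDimensional.proper_real E
  obtain ⟨R, hR⟩ := exists_gt (max 0 ((β₀ + α₀ * ‖x₀‖ - t) / (α₀ - α)))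
  obtain ⟨hR0, hRα⟩ := max_lt_iff.1 hR
  rw [div_lt_iff₀ (sub_pos.2 hαα₀)] at hRα
  have hsphere : ∀ᶠ k in l, ∀ w ∈ sphere x₀ R, F k w < Real.exp (t - α * R) := by
    refine h.eventually_forall_lt_of_isCompact (isCompact_sphere x₀ R) fun w hw => ?_
    refine (hf w).trans_lt (Real.exp_lt_exp.2 ?_)
    have hnorm : R - ‖x₀‖ ≤ ‖w‖ := by
      rw [← mem_sphere_iff_norm.1 hw]
      linarith [norm_sub_le w x₀]
    linarith [mul_le_mul_of_nonneg_left hnorm (hα.trans hαα₀).le]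
  refine ⟨max t (M + α * R) + α * ‖x₀‖, ?_⟩
  filter_upwards [hF, hbounds, hsphere] with k hFk hbk hk x
  have hdecay := hFk.le_exp_sub_norm hR0 (mul_nonneg hα.le hR0.le) (hbk.exp_le _ (mem_ball_self hρ))
    (fun w hw => (hk w hw).le) hbk.le_exp x
  rwa [mul_div_cancel_right₀ α hR0.ne'] at hdecay

theorem tendsto_lintegral_exp_mul_abs_sub {ι E : Type*} [NormedAddCommGroup E] [NormedSpace ℝ E]
    [FiniteDimensional ℝ E] [MeasurableSpace E] [BorelSpace E] {μ : Measure E} [μ.IsAddHaarMeasure]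
    {l : Filter ι} [l.NeBot] [l.IsCountablyGenerated] {F : ι → E → ℝ} {f : E → ℝ} {a b α : ℝ}
    (hα : α < b) (hFm : ∀ᶠ k in l, Measurable (F k)) (hf : Measurable f)
    (hF : ∀ᶠ k in l, ∀ x, 0 ≤ F k x ∧ F k x ≤ Real.exp (a - b * ‖x‖))
    (hlim : ∀ᵐ x ∂μ, Tendsto (fun k => F k x) l (𝓝 (f x))) :
    Tendsto (fun k => ∫⁻ x, ENNReal.ofReal (Real.exp (α * ‖x‖) * |F k x - f x|) ∂μ) l (𝓝 0) := by
  have hf0 : ∀ᵐ x ∂μ, 0 ≤ f x ∧ f x ≤ Real.exp (a - b * ‖x‖) := by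
    filter_upwards [hlim] with x hx
    exact ⟨ge_of_tendsto hx (hF.mono fun k hk => (hk x).1),
      le_of_tendsto hx (hF.mono fun k hk => (hk x).2)⟩
  suffices Tendsto (fun k => ∫⁻ x, ENNReal.ofReal (Real.exp (α * ‖x‖) * |F k x - f x|) ∂μ) l
      (𝓝 (∫⁻ _, 0 ∂μ)) by simpa only [lintegral_zero] using this
  refine tendsto_lintegral_filter_of_dominated_convergence
    (fun x => ENNReal.ofReal (Real.exp (a - (b - α) * ‖x‖))) ?_ ?_
    (lintegral_exp_sub_norm_lt_top μ a (sub_pos.2 hα)).ne ?_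
  · filter_upwards [hFm] with k hk
    fun_prop
  · filter_upwards [hF] with k hk
    filter_upwards [hf0] with x hx
    refine ENNReal.ofReal_le_ofReal ?_
    calc Real.exp (α * ‖x‖) * |F k x - f x| ≤ Real.exp (α * ‖x‖) * Real.exp (a - b * ‖x‖) := by
          gcongr
          exact abs_sub_le_of_nonneg_of_le (hk x).1 (hk x).2 hx.1 hx.2
      _ = Real.exp (a - (b - α) * ‖x‖) := by rw [← Real.exp_add]; ring_nf
  · filter_upwards [hlim] with x hx
    have hweighted : Tendsto (fun k => Real.exp (α * ‖x‖) * |F k x - f x|) l (𝓝 0) := by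
      simpa using ((hx.sub_const (f x)).abs).const_mul (Real.exp (α * ‖x‖))
    simpa using ENNReal.tendsto_ofReal hweighted

theorem tendsto_lintegral_exp_mul_abs_sub_of_isMaximiser {d : ℕ}
    {Q : ℕ → ProbabilityMeasure (Eucl d)} {P : ProbabilityMeasure (Eucl d)}
    {F : ℕ → Eucl d → ℝ} {f : Eucl d → ℝ} (hP : InClassP (P : Measure (Eucl d)))
    (hQ : Tendsto Q atTop (𝓝 P)) (hF : ∀ᶠ k in atTop, IsMaximiser (Q k : Measure (Eucl d)) (F k))
    (hf : IsMaximiser (P : Measure (Eucl d)) f)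
    (hval : extIntegral (logFun f) P ≤ liminf (fun k => extIntegral (logFun f) (Q k)) atTop)
    {α₀ β₀ α : ℝ} (hα₀ : 0 < α₀) (hα : α < α₀) (hbound : ∀ x, f x ≤ Real.exp (-α₀ * ‖x‖ + β₀)) :
    Tendsto (fun k => ∫⁻ x, ENNReal.ofReal (Real.exp (α * ‖x‖) * |F k x - f x|)) atTop (𝓝 0) := by
  have hlik : extIntegral (logFun f) P ≤
      liminf (fun k => extIntegral (logFun (F k)) (Q k)) atTop :=
    hval.trans (liminf_le_liminf (hF.mono fun k hk => hk.2 f hf.1))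
  have hfbot := hf.extIntegral_ne_bot hP
  obtain ⟨x₀, ρ, t, M, hρ, hbounds⟩ := eventually_hasExpBounds hP hQ (hF.mono fun k hk => hk.1)
    (ne_bot_of_le_ne_bot hfbot hlik)
  obtain ⟨α', hα', hα'α₀⟩ := exists_between (max_lt hα hα₀)
  refine tendsto_of_subseq_tendsto fun ns hns => ?_
  have hliks : extIntegral (logFun f) P ≤
      liminf (fun k => extIntegral (logFun (F (ns k))) (Q (ns k))) atTop :=
    hlik.trans (liminf_le_liminf_of_le hns)
  obtain ⟨φ, hφ, h, hh, hlim, hmax⟩ := exists_subseq_isLogConcaveDensity hP (hQ.comp hns)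
    (hns.eventually (hF.mono fun k hk => hk.1)) (ne_bot_of_le_ne_bot hfbot hliks)
  obtain rfl : h = f := IsMaximiser.unique
    ⟨hh, fun e he => (hf.2 e he).trans (hliks.trans hmax)⟩ hP hf
  have hsub : Tendsto (ns ∘ φ) atTop atTop := hns.comp hφ.tendsto_atTop
  have hFsub := hsub.eventually (hF.mono fun k hk => hk.1)
  have hconc := hFsub.mono fun k hk => hk.logConcave
  obtain ⟨a, ha⟩ := hlim.eventually_le_exp_sub_norm hconc hρ (hsub.eventually hbounds)
    (max_lt_iff.1 hα').2 hα'α₀ hbound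
  exact ⟨φ, tendsto_lintegral_exp_mul_abs_sub (max_lt_iff.1 hα').1
    (hFsub.mono fun k hk => hk.measurable) hh.measurable
    ((hFsub.and ha).mono fun k hk x => ⟨hk.1.nonneg x, hk.2 x⟩)
    (hlim.ae_tendsto hconc volume)⟩

end Stability

section StrongLaw

variable {Ω : Type*} [MeasurableSpace Ω] {μ : Measure Ω}

theorem strong_law_ae_ennreal {Y : ℕ → Ω → ENNReal} (hY : ∫⁻ ω, Y 0 ω ∂μ ≠ ⊤)
    (hindep : Pairwise fun i j => IndepFun (Y i) (Y j) μ)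
    (hident : ∀ i, IdentDistrib (Y i) (Y 0) μ μ) :
    ∀ᵐ ω ∂μ, Tendsto (fun n : ℕ => (n : ENNReal)⁻¹ * ∑ i ∈ Finset.range n, Y i ω) atTop
      (𝓝 (∫⁻ ω, Y 0 ω ∂μ)) := by
  have hmeas := (hident 0).aemeasurable_snd
  have hfin : ∀ᵐ ω ∂μ, ∀ i, Y i ω < ⊤ := ae_all_iff.2 fun i =>
    ae_lt_top' (hident i).aemeasurable_fst ((hident i).lintegral_eq.trans_ne hY)
  filter_upwards [strong_law_ae_real (fun i ω => (Y i ω).toReal)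
    (integrable_toReal_of_lintegral_ne_top hmeas hY)
    (fun i j hij => (hindep hij).comp ENNReal.measurable_toReal ENNReal.measurable_toReal)
    fun i => (hident i).comp ENNReal.measurable_toReal, hfin] with ω hω hfinω
  have hint : ∫ ω, (Y 0 ω).toReal ∂μ = (∫⁻ ω, Y 0 ω ∂μ).toReal :=
    integral_toReal hmeas (hfin.mono fun ω h => h 0)
  rw [hint] at hω
  have hlim := ENNReal.tendsto_ofReal hω
  rw [ENNReal.ofReal_toReal hY] at hlim
  refine hlim.congr' ?_
  filter_upwards [eventually_gt_atTop 0] with n hn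
  rw [ENNReal.ofReal_div_of_pos (Nat.cast_pos.2 hn),
    ENNReal.ofReal_sum_of_nonneg fun _ _ => ENNReal.toReal_nonneg, ENNReal.ofReal_natCast,
    ENNReal.div_eq_inv_mul]
  simp only [ENNReal.ofReal_toReal (hfinω _).ne]

/-- Countably many sets, the finite intersections of members of a countable basis, determine weak
convergence, so that their exceptional null sets can be combined. -/
theorem ae_tendsto_probabilityMeasure_of_forall_isOpen {E : Type*} [TopologicalSpace E]
    [SecondCountableTopology E] [MeasurableSpace E] [OpensMeasurableSpace E]
    {Q : Ω → ℕ → ProbabilityMeasure E} {P : ProbabilityMeasure E}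
    (h : ∀ U : Set E, IsOpen U →
      ∀ᵐ ω ∂μ, Tendsto (fun n => (Q ω n : Measure E) U) atTop (𝓝 ((P : Measure E) U))) :
    ∀ᵐ ω ∂μ, Tendsto (Q ω) atTop (𝓝 P) := by
  obtain ⟨b, hbc, -, hb⟩ := TopologicalSpace.exists_countable_basis E
  let S : Set (Set E) := Set.sInter '' {t | t.Finite ∧ t ⊆ b}
  have hS : TopologicalSpace.IsTopologicalBasis S :=
    TopologicalSpace.isTopologicalBasis_of_subbasis hb.eq_generateFrom
  have hSpi : IsPiSystem S := by
    rintro _ ⟨t, ⟨ht, htb⟩, rfl⟩ _ ⟨u, ⟨hu, hub⟩, rfl⟩ -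
    exact ⟨t ∪ u, ⟨ht.union hu, Set.union_subset htb hub⟩, Set.sInter_union t u⟩
  have hae : ∀ᵐ ω ∂μ, ∀ U ∈ S,
      Tendsto (fun n => (Q ω n : Measure E) U) atTop (𝓝 ((P : Measure E) U)) :=
    (ae_ball_iff ((Set.countable_ofPred_finite_subset hbc).image _)).2 fun U hU =>
      h U (hS.isOpen hU)
  filter_upwards [hae] with ω hω
  refine hSpi.tendsto_probabilityMeasure_of_tendsto_of_mem
    (fun U hU => (hS.isOpen hU).measurableSet) (fun U hU x hx => ?_) fun U hU =>
      (ENNReal.tendsto_toNNReal (measure_ne_top _ _)).comp (hω U hU)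
  obtain ⟨V, hV, hxV, hVU⟩ := hS.exists_subset_of_mem_open hx hU
  exact ⟨V, hV, (hS.isOpen hV).mem_nhds hxV, hVU⟩

end StrongLaw

section Empirical

variable {d : ℕ}

theorem isProbabilityMeasure_empirical_succ (x : ℕ → Eucl d) (n : ℕ) :
    IsProbabilityMeasure (empirical x (n + 1)) := by
  constructor
  simp only [empirical, Measure.smul_apply, Measure.finsetSum_apply, measure_univ,
    Finset.sum_const, Finset.card_range, nsmul_eq_mul, mul_one, smul_eq_mul]
  exact ENNReal.inv_mul_cancel (by simp) (ENNReal.natCast_ne_top _)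

/-- The empirical distribution of the points `x 0, …, x n`, as an element of the space of
probability measures with the weak topology. The shift of the index excludes the empty sample, whose
empirical distribution is the zero measure. -/
noncomputable def empiricalProb (x : ℕ → Eucl d) (n : ℕ) : ProbabilityMeasure (Eucl d) :=
  ⟨empirical x (n + 1), isProbabilityMeasure_empirical_succ x n⟩

theorem lintegral_empirical (x : ℕ → Eucl d) (n : ℕ) (g : Eucl d → ENNReal) :
    ∫⁻ y, g y ∂empirical x n = (n : ENNReal)⁻¹ * ∑ i ∈ Finset.range n, g (x i) := by
  simp only [empirical, lintegral_smul_measure, lintegral_finsetSum_measure, lintegral_dirac,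
    smul_eq_mul]

theorem lintegral_empiricalProb_lt_top (x : ℕ → Eucl d) (n : ℕ) {g : Eucl d → ENNReal}
    (hg : ∀ i, g (x i) < ⊤) : ∫⁻ y, g y ∂(empiricalProb x n : Measure (Eucl d)) < ⊤ :=
  (lintegral_empirical x (n + 1) g).trans_lt
    (ENNReal.mul_lt_top (by simp) (ENNReal.sum_lt_top.2 fun i _ => hg i))

theorem InClassP.eventually_of_tendsto {ι : Type*} {l : Filter ι}
    {Q : ι → ProbabilityMeasure (Eucl d)} {P : ProbabilityMeasure (Eucl d)}
    (hP : InClassP (P : Measure (Eucl d))) (hQ : Tendsto Q l (𝓝 P))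
    (hmean : ∀ᶠ k in l, ∫⁻ x, ENNReal.ofReal ‖x‖ ∂(Q k : Measure (Eucl d)) < ⊤) :
    ∀ᶠ k in l, InClassP (Q k : Measure (Eucl d)) := by
  obtain ⟨s, x₀, ρ, hρ, hs, hball⟩ := hP.exists_isBallForcing
  obtain ⟨η, hη, -, hQη⟩ := exists_forall_ofReal_le_measure_of_tendsto hQ hs
  filter_upwards [hQη, hmean] with k hk hmeank
  exact hball.inClassP hρ (fun A hA => (ENNReal.ofReal_pos.2 hη).trans_le (hk A hA)) hmeank

variable {Ω : Type*} [MeasurableSpace Ω] {μ : Measure Ω} {P : Measure (Eucl d)}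
  {X : ℕ → Ω → Eucl d}

theorem ae_tendsto_lintegral_empirical (hlaw : ∀ i, HasLaw (X i) P μ)
    (hindep : Pairwise fun i j => IndepFun (X i) (X j) μ) {g : Eucl d → ENNReal}
    (hg : Measurable g) (hgP : ∫⁻ x, g x ∂P ≠ ⊤) :
    ∀ᵐ ω ∂μ, Tendsto (fun n => ∫⁻ x, g x ∂empirical (fun i => X i ω) n) atTop
      (𝓝 (∫⁻ x, g x ∂P)) := by
  have hcomp : ∫⁻ ω, g (X 0 ω) ∂μ = ∫⁻ x, g x ∂P := (hlaw 0).lintegral_comp hg.aemeasurable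
  have hident : ∀ i, IdentDistrib (X i) (X 0) μ μ := fun i =>
    ⟨(hlaw i).aemeasurable, (hlaw 0).aemeasurable, (hlaw i).map_eq.trans (hlaw 0).map_eq.symm⟩
  simpa only [lintegral_empirical, Function.comp_apply, hcomp] using
    strong_law_ae_ennreal (Y := fun i => g ∘ X i) (hcomp.trans_ne hgP)
      (fun i j hij => (hindep hij).comp hg hg) fun i => (hident i).comp hg

theorem ae_tendsto_empiricalProb {P : ProbabilityMeasure (Eucl d)}
    (hlaw : ∀ i, HasLaw (X i) (P : Measure (Eucl d)) μ)
    (hindep : Pairwise fun i j => IndepFun (X i) (X j) μ) :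
    ∀ᵐ ω ∂μ, Tendsto (empiricalProb fun i => X i ω) atTop (𝓝 P) := by
  refine ae_tendsto_probabilityMeasure_of_forall_isOpen fun U hU => ?_
  filter_upwards [ae_tendsto_lintegral_empirical hlaw hindep (g := U.indicator 1)
    (measurable_one.indicator hU.measurableSet)
    (by simp only [lintegral_indicator_one hU.measurableSet]; exact measure_ne_top _ _)] with ω hω
  simp only [lintegral_indicator_one hU.measurableSet] at hω
  exact (tendsto_add_atTop_iff_nat 1).2 hω

theorem ae_tendsto_extIntegral_logFun_empiricalProb [IsProbabilityMeasure P]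
    (hlaw : ∀ i, HasLaw (X i) P μ) (hindep : Pairwise fun i j => IndepFun (X i) (X j) μ)
    {f : Eucl d → ℝ} {M : ℝ} (hf : Measurable f) (hM : ∀ x, f x ≤ Real.exp M)
    (hlik : extIntegral (logFun f) P ≠ ⊥) :
    ∀ᵐ ω ∂μ, Tendsto (fun n => extIntegral (logFun f) (empiricalProb (fun i => X i ω) n)) atTop
      (𝓝 (extIntegral (logFun f) P)) := by
  rw [extIntegral_logFun_eq P hf hM] at hlik ⊢
  have hfin : ∫⁻ x, logDeficit M (f x) ∂P ≠ ⊤ := fun htop => hlik (by simp [htop])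
  filter_upwards [ae_tendsto_lintegral_empirical hlaw hindep
    ((measurable_logDeficit M).comp hf) hfin] with ω hω
  simp only [extIntegral_logFun_eq _ hf hM, sub_eq_add_neg]
  have hneg := (continuous_neg.tendsto _).comp
    ((continuous_coe_ennreal_ereal.tendsto _).comp ((tendsto_add_atTop_iff_nat 1).2 hω))
  exact (EReal.continuousAt_add (.inl (EReal.coe_ne_top M))
    (.inl (EReal.coe_ne_bot M))).tendsto.comp (tendsto_const_nhds.prodMk_nhds hneg)

end Empirical

end LogConcaveMLE

theorem mainTheorem4_general {d : ℕ} {Ω : Type*} [MeasurableSpace Ω] (μ : Measure Ω)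
    (P : Measure (EuclideanSpace ℝ (Fin d))) (hP : LogConcaveMLE.InClassP P)
    (X : ℕ → Ω → EuclideanSpace ℝ (Fin d)) (hlaw : ∀ i, HasLaw (X i) P μ)
    (hindep : Pairwise fun i j => IndepFun (X i) (X j) μ) :
    LogConcaveMLE.ProjWellDefined P ∧
    (∃ α₀ : ℝ, 0 < α₀ ∧ ∃ β₀ : ℝ, ∀ x : EuclideanSpace ℝ (Fin d),
      LogConcaveMLE.logConcaveProj P x ≤ Real.exp (-α₀ * ‖x‖ + β₀)) ∧
    ∀ᵐ ω ∂μ,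
      (∀ᶠ n in atTop,
        LogConcaveMLE.ProjWellDefined (LogConcaveMLE.empirical (fun i => X i ω) n)) ∧
      ∀ α₀ : ℝ, 0 < α₀ → ∀ β₀ : ℝ,
        (∀ x : EuclideanSpace ℝ (Fin d),
          LogConcaveMLE.logConcaveProj P x ≤ Real.exp (-α₀ * ‖x‖ + β₀)) →
        ∀ α : ℝ, α < α₀ →
          Tendsto (fun n : ℕ => ∫⁻ x : EuclideanSpace ℝ (Fin d), ENNReal.ofReal
              (Real.exp (α * ‖x‖) *
                |LogConcaveMLE.logConcaveProj (LogConcaveMLE.empirical (fun i => X i ω) n) x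
                  - LogConcaveMLE.logConcaveProj P x|))
            atTop (𝓝 0) := by
  obtain ⟨P, rfl⟩ : ∃ P' : ProbabilityMeasure (EuclideanSpace ℝ (Fin d)), (P' : Measure _) = P :=
    ⟨⟨P, hP.isProbabilityMeasure⟩, rfl⟩
  have hmax := hP.isMaximiser_logConcaveProj
  obtain ⟨a, b, hb, hab⟩ := hmax.1.exists_le_exp_sub_norm
  have hbdd (x) : LogConcaveMLE.logConcaveProj P x ≤ Real.exp a :=
    (hab x).trans (Real.exp_le_exp.2 (sub_le_self a (by positivity)))
  refine ⟨hP.projWellDefined, ⟨b, hb, a, fun x => by simpa [neg_add_eq_sub] using hab x⟩, ?_⟩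
  filter_upwards [LogConcaveMLE.ae_tendsto_empiricalProb hlaw hindep,
    LogConcaveMLE.ae_tendsto_extIntegral_logFun_empiricalProb hlaw hindep hmax.1.measurable hbdd
      (hmax.extIntegral_ne_bot hP)] with ω hweak hlik
  have hclass := LogConcaveMLE.InClassP.eventually_of_tendsto hP hweak (.of_forall fun _ =>
    LogConcaveMLE.lintegral_empiricalProb_lt_top _ _ fun _ => ENNReal.ofReal_lt_top)
  refine ⟨?_, fun α₀ hα₀ β₀ hbound α hα => ?_⟩
  · rw [← map_add_atTop_eq_nat 1]
    exact hclass.mono fun n hn => hn.projWellDefined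
  · rw [← tendsto_add_atTop_iff_nat 1]
    exact LogConcaveMLE.tendsto_lintegral_exp_mul_abs_sub_of_isMaximiser hP hweak
      (hclass.mono fun n hn => hn.isMaximiser_logConcaveProj) hmax hlik.liminf_eq.ge hα₀ hα hbound

theorem mainTheorem4 {d : ℕ} (hd : 1 ≤ d)
    {Ω : Type*} [MeasurableSpace Ω] (μ : Measure Ω) [IsProbabilityMeasure μ]
    (P : Measure (EuclideanSpace ℝ (Fin d))) (hP : LogConcaveMLE.InClassP P)
    (X : ℕ → Ω → EuclideanSpace ℝ (Fin d))
    (hX : ∀ i, Measurable (X i)) (hindep : iIndepFun X μ) (hlaw : ∀ i, μ.map (X i) = P) :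
    LogConcaveMLE.ProjWellDefined P ∧
    (∃ α₀ : ℝ, 0 < α₀ ∧ ∃ β₀ : ℝ, ∀ x : EuclideanSpace ℝ (Fin d),
      LogConcaveMLE.logConcaveProj P x ≤ Real.exp (-α₀ * ‖x‖ + β₀)) ∧
    ∀ᵐ ω ∂μ,
      (∀ᶠ n in atTop,
        LogConcaveMLE.ProjWellDefined (LogConcaveMLE.empirical (fun i => X i ω) n)) ∧
      ∀ α₀ : ℝ, 0 < α₀ → ∀ β₀ : ℝ,
        (∀ x : EuclideanSpace ℝ (Fin d),
          LogConcaveMLE.logConcaveProj P x ≤ Real.exp (-α₀ * ‖x‖ + β₀)) →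
        ∀ α : ℝ, α < α₀ →
          Tendsto (fun n : ℕ => ∫⁻ x : EuclideanSpace ℝ (Fin d), ENNReal.ofReal
              (Real.exp (α * ‖x‖) *
                |LogConcaveMLE.logConcaveProj (LogConcaveMLE.empirical (fun i => X i ω) n) x
                  - LogConcaveMLE.logConcaveProj P x|))
            atTop (𝓝 0) :=
  mainTheorem4_general μ P hP X (fun i => ⟨(hX i).aemeasurable, hlaw i⟩)
    fun _ _ hij => hindep.indepFun hij
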